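/- Write $\mathbb{C}/\langle i\rangle$ for the flat cylinder with coordinate $z$. A meromorphic function $g\colon\mathbb{C}/\langle i\rangle\to\mathbb{C}\cup\{\infty\}$ is called quasiperiodic if (1) there is $C>0$ such that any two distinct points of $g^{-1}(\{0,\infty\})$ have distance at least $C$, and every $p\in g^{-1}(\{0,\infty\})$ has another point of $g^{-1}(\{0,\infty\})$ at distance less than $1/C$; and (2) for every divergent sequence $\{z_k\}_k\subset\mathbb{C}/\langle i\rangle$, a subsequence of $g_k(z)=g(z+z_k)$ converges, uniformly on compact subsets (in the spherical metric), to a non-constant meromorphic function on $\mathbb{C}/\langle i\rangle$. Let $\mathcal{W}$ be the set of quasiperiodic $g$ with divisor $(g)=\prod_{j\in\mathbb{Z}}p_j^2q_j^{-2}$ (infinitely many zeros $p_j$ and poles $q_j$, all of order exactly two), and let $\mathcal{M}_{\mathrm{imm}}$ be the set of $g\in\mathcal{W}$ that solve the period problem $$\int_\gamma \frac{dz}{g}=\overline{\int_\gamma g\,dz},\qquad \mathrm{Res}_{p_j}\frac{dz}{g}=0,\qquad \mathrm{Res}_{q_j}(g\,dz)=0\quad(j\in\mathbb{Z}),$$ where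 $\gamma$ is the generator $\{x+it\mid 0\le t\le 1\}$ of the homology of the cylinder, at any $x$ for which it avoids the zeros and poles of $g$. For $g\in\mathcal{M}_{\mathrm{imm}}$, the minimal immersion $$X=\mathrm{Re}\int\Big(\tfrac12\big(\tfrac1g-g\big),\ \tfrac{i}{2}\big(\tfrac1g+g\big),\ 1\Big)dz\colon\ (\mathbb{C}/\langle i\rangle)-g^{-1}(\{0,\infty\})\to\mathbb{R}^3$$ defines a surface $M$, called a quasiperiodic, immersed minimal surface of Riemann type. Its Gauss map is $N=\frac{1}{1+|g|^2}\big(2\,\mathrm{Re}\,g,\,2\,\mathrm{Im}\,g,\,|g|^2-1\big)$ and its Shiffman function is $$S_M=\mathrm{Im}\Big[\tfrac32\Big(\frac{g'}{g}\Big)^2-\frac{g''}{g}-\frac{1}{1+|g|^2}\Big(\frac{g'}{g}\Big)^2\Big].$$ $S_M$ is called linear if there is $a\in\mathbb{R}^3$ with $S_M=\langle N,a\rangle$ on $M$. **Lemma.** Let $M$ be a quasiperiodic, immersed minimal surface of Riemann type whose Shiffman function $S_M$ is linear. Then $M$ is singly-periodic: there is $v\in\mathbb{R}^3-\{0\}$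 such that $M+v=M$ and such that the vectors $w$ for which there is a homeomorphism $\varphi$ of $(\mathbb{C}/\langle i\rangle)-g^{-1}(\{0,\infty\})$ with $X\circ\varphi=X+w$ and $N\circ\varphi=N$ (the orientation preserving translational symmetries of $M$) are exactly the integer multiples of $v$. Moreover, the smallest orientable quotient surface of $M$ in $\mathbb{R}^3/\langle v\rangle$, that is, the quotient of $M$ by the group of all orientation preserving translational symmetries $\varphi$, is a properly immersed minimal torus with two planar ends and total curvature $-8\pi$: it is conformally $\mathbb{C}/\Lambda$ minus two points for a lattice $\Lambda\subset\mathbb{C}$ (with conformal coordinate $z$), the map that $X$ induces from it into $\mathbb{R}^3/\langle v\rangle$ is a proper minimal immersion, its two ends are planar, and $\int K\,dA=-8\pi$ over it. Here a planar end is one that, after a linear isometry of $\mathbb{R}^3$, is a graph over the exterior of a disk in the $(x_1,x_2)$-plane with height $b+\frac{c_1x_1+c_2x_2}{r^2}+O(r^{-2})$, where $r^2=x_1^2+x_2^2$. -/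

import Mathlib

open Filter Topology MeasureTheory Set

noncomputable section

namespace RiemannType

/-- Euclidean three-space. -/
abbrev E3 : Type := EuclideanSpace ℝ (Fin 3)

/-- The flat cylinder `ℂ / ⟨i⟩`, with its quotient topology and quotient distance. -/
abbrev Cyl : Type := ℂ ⧸ AddSubgroup.zmultiples Complex.I

/-- The lift of a function on the cylinder to an `i`-periodic function on `ℂ`. -/
def lift {α : Type*} (g : Cyl → α) : ℂ → α := fun z => g (z : Cyl)

/-- Meromorphic functions `ℂ / ⟨i⟩ → ℂ ∪ {∞}` (other than the constant `∞`) are encoded by complex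
valued functions whose lift is meromorphic and in normal form everywhere: the function takes its
true value off its poles, and the placeholder value `0` at its poles, which are recognised by
their negative order. -/
def IsMeromorphicCyl (g : Cyl → ℂ) : Prop := MeromorphicNFOn (lift g) univ

/-- Inverse stereographic projection from the north pole, at a finite point. -/
def invStereo (w : ℂ) : E3 :=
  (1 / (‖w‖ ^ 2 + 1)) • !₂[2 * w.re, 2 * w.im, ‖w‖ ^ 2 - 1]

/-- The value at `z` of the meromorphic function `f`, viewed as a point of the unit sphere
(the point `∞` of the Riemann sphere being the north pole). -/
def sphereValue (f : ℂ → ℂ) (z : ℂ) : E3 :=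
  if meromorphicOrderAt f z < 0 then !₂[0, 0, 1] else invStereo (f z)

/-- The meromorphic function `g` on the cylinder viewed as a map into the unit sphere; this is the
spherical Gauss map `N` associated to `g`. -/
def gaussMap (g : Cyl → ℂ) (x : Cyl) : E3 :=
  sphereValue (lift (fun y => g (x + y))) 0

/-- The set of zeros and poles `g⁻¹({0, ∞})` in the cylinder. -/
def zeroPoleSet (g : Cyl → ℂ) : Set Cyl :=
  {x | ∃ z : ℂ, (z : Cyl) = x ∧ meromorphicOrderAt (lift g) z ≠ 0}

/-- The punctured cylinder `(ℂ / ⟨i⟩) - g⁻¹({0, ∞})`. -/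
def puncturedCyl (g : Cyl → ℂ) : Set Cyl := (zeroPoleSet g)ᶜ

/-- Quasiperiodic meromorphic functions on the cylinder. Convergence of meromorphic functions,
uniform on compact sets, is with respect to the chordal distance of the Riemann sphere. -/
structure IsQuasiperiodic (g : Cyl → ℂ) : Prop where
  meromorphic : IsMeromorphicCyl g
  spacing : ∃ C : ℝ, 0 < C ∧
    (∀ p ∈ zeroPoleSet g, ∀ q ∈ zeroPoleSet g, p ≠ q → C ≤ dist p q) ∧
    (∀ p ∈ zeroPoleSet g, ∃ q ∈ zeroPoleSet g, q ≠ p ∧ dist p q < 1 / C)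
  limits : ∀ ζ : ℕ → Cyl, Tendsto ζ atTop (cocompact Cyl) →
    ∃ (s : ℕ → ℕ) (gInf : Cyl → ℂ), StrictMono s ∧ IsMeromorphicCyl gInf ∧
      (¬ ∃ c : ℂ, ∀ x, gInf x = c) ∧
      ∀ K : Set Cyl, IsCompact K →
        TendstoUniformlyOn (fun k x => gaussMap g (x + ζ (s k))) (gaussMap gInf) atTop K

/-- The space `𝒲` of quasiperiodic meromorphic functions on the cylinder whose divisor is
`∏_{j ∈ ℤ} p_j² q_j⁻²`: double zeros at the `p_j`, double poles at the `q_j`, no others. -/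
structure MemW (g : Cyl → ℂ) : Prop where
  quasiperiodic : IsQuasiperiodic g
  divisor : ∃ p q : ℤ → Cyl, Function.Injective p ∧ Function.Injective q ∧
    ∀ z : ℂ,
      ((z : Cyl) ∈ range p → meromorphicOrderAt (lift g) z = 2) ∧
      ((z : Cyl) ∈ range q → meromorphicOrderAt (lift g) z = -2) ∧
      ((z : Cyl) ∉ range p ∪ range q → meromorphicOrderAt (lift g) z = 0)

/-- The meromorphic differential `f dz` has residue zero at `z`. -/
def ResidueZeroAt (f : ℂ → ℂ) (z : ℂ) : Prop :=
  ∀ᶠ r : ℝ in 𝓝[>] 0, (∮ ζ in C(z, r), f ζ) = 0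

/-- The space `𝓜_imm` of functions in `𝒲` that solve the period problem: `dz / g` has residue zero
at the zeros of `g`, `g dz` has residue zero at the poles of `g`, and, for the generator
`γ = {x + i t | t ∈ [0, 1]}` of the homology of the cylinder (at any abscissa `x` for which `γ`
avoids the zeros and poles), `∫_γ dz / g = a` and `∫_γ g dz = conj a`. -/
structure MemMimm (g : Cyl → ℂ) : Prop where
  memW : MemW g
  residue_zero : ∀ z : ℂ, 0 < meromorphicOrderAt (lift g) z →
    ResidueZeroAt (fun ζ => 1 / lift g ζ) z
  residue_pole : ∀ z : ℂ, meromorphicOrderAt (lift g) z < 0 → ResidueZeroAt (lift g) z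
  period : ∃ a : ℂ, ∀ x : ℝ,
    (∀ t : ℝ, (((x + t * Complex.I : ℂ)) : Cyl) ∈ puncturedCyl g) →
      (∫ t in (0 : ℝ)..1, (1 / lift g (x + t * Complex.I)) * Complex.I) = a ∧
      (∫ t in (0 : ℝ)..1, lift g (x + t * Complex.I) * Complex.I) = (starRingEnd ℂ) a

/-- The Weierstrass form `((1/g - g)/2, i (1/g + g)/2, 1)` of the pair `(g, dz)`. -/
def weierstrassForm (f : ℂ → ℂ) (z : ℂ) : Fin 3 → ℂ :=
  ![(1 / 2) * (1 / f z - f z), (Complex.I / 2) * (1 / f z + f z), 1]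

/-- `X` is the minimal immersion with Weierstrass pair `(g, dz)` on the punctured cylinder:
`X = Re ∫ ((1/g - g)/2, i (1/g + g)/2, 1) dz`, i.e. `dX_j = Re (Φ_j dz)`. (The values of `X` at the
zeros and poles of `g` are irrelevant.) -/
def HasWeierstrassPair (g : Cyl → ℂ) (X : Cyl → E3) : Prop :=
  ∀ z : ℂ, (z : Cyl) ∈ puncturedCyl g → ∀ j : Fin 3,
    HasFDerivAt (fun ζ : ℂ => lift X ζ j)
      (Complex.reCLM.comp (weierstrassForm (lift g) z j • ContinuousLinearMap.id ℝ ℂ)) z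

/-- A quasiperiodic immersed minimal surface of Riemann type, given by its parametrization `X`
and its (stereographically projected) Gauss map `g`. -/
structure IsRiemannTypeSurface (g : Cyl → ℂ) (X : Cyl → E3) : Prop where
  memMimm : MemMimm g
  weierstrass : HasWeierstrassPair g X

/-- The Shiffman function of the surface with Weierstrass pair `(g, dz)`. -/
def shiffman (g : Cyl → ℂ) (z : ℂ) : ℝ :=
  let f := lift g
  Complex.im ((3 / 2) * (deriv f z / f z) ^ 2 - deriv (deriv f) z / f z
    - (1 / (1 + (‖f z‖ : ℂ) ^ 2)) * (deriv f z / f z) ^ 2)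

/-- The Shiffman function is a linear Jacobi function: it equals `⟨N, a⟩` on the surface for some
`a ∈ ℝ³`. -/
def ShiffmanLinear (g : Cyl → ℂ) : Prop :=
  ∃ a : E3, ∀ z : ℂ, (z : Cyl) ∈ puncturedCyl g →
    shiffman g z = inner ℝ (gaussMap g (z : Cyl)) a

/-- An orientation preserving translational symmetry of the immersed surface `X`, with translation
vector `w`: a homeomorphism `φ` of the surface with `X ∘ φ = X + w` that preserves the
unit normal. -/
def IsOrientedTranslation (g : Cyl → ℂ) (X : Cyl → E3) (w : E3)
    (φ : puncturedCyl g ≃ₜ puncturedCyl g) : Prop :=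
  ∀ x : puncturedCyl g, X (φ x) = X x + w ∧ gaussMap g (φ x) = gaussMap g x

/-- Two points of the surface are identified if an orientation preserving translational symmetry
maps one to the other. -/
def translationSetoid (g : Cyl → ℂ) (X : Cyl → E3) : Setoid (puncturedCyl g) where
  r x y := ∃ (w : E3) (φ : puncturedCyl g ≃ₜ puncturedCyl g),
    IsOrientedTranslation g X w φ ∧ φ x = y
  iseqv :=
    { refl := fun x => ⟨0, Homeomorph.refl _, fun y => ⟨by simp, rfl⟩, rfl⟩
      symm := by
        rintro x y ⟨w, φ, h, rfl⟩
        refine ⟨-w, φ.symm, fun y => ?_, by simp⟩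
        have hy := h (φ.symm y)
        rw [φ.apply_symm_apply] at hy
        exact ⟨by rw [hy.1]; simp, hy.2.symm⟩
      trans := by
        rintro x y z ⟨w, φ, h, rfl⟩ ⟨w', φ', h', rfl⟩
        refine ⟨w + w', φ.trans φ', fun y => ⟨?_, ?_⟩, rfl⟩
        · change X (φ' (φ y)) = _
          rw [(h' (φ y)).1, (h y).1, add_assoc]
        · change gaussMap g (φ' (φ y)) = _
          rw [(h' (φ y)).2, (h y).2] }

/-- The smallest orientable quotient of the surface: its quotient by the group of all orientation
preserving translational symmetries. -/
abbrev OrientableQuotient (g : Cyl → ℂ) (X : Cyl → E3) : Type :=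
  Quotient (translationSetoid g X)

section ParametrizedSurfaces

/-- Partial derivatives of a parametrized surface with respect to the coordinates `x`, `y` of
`z = x + i y`. -/
def dx (Y : ℂ → E3) (z : ℂ) : E3 := fderiv ℝ Y z 1

def dy (Y : ℂ → E3) (z : ℂ) : E3 := fderiv ℝ Y z Complex.I

/-- `Y` is a conformal minimal immersion near `z`: it is conformal with nonvanishing differential
and its coordinate functions are harmonic. -/
def IsMinimalImmersionAt (Y : ℂ → E3) (z : ℂ) : Prop :=
  (∀ᶠ ζ in 𝓝 z, dx Y ζ ≠ 0 ∧ ‖dx Y ζ‖ = ‖dy Y ζ‖ ∧ inner ℝ (dx Y ζ) (dy Y ζ) = 0) ∧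
  ∀ j : Fin 3, InnerProductSpace.HarmonicAt (fun ζ => Y ζ j) z

/-- The vector product in `ℝ³`. -/
def cross (a b : E3) : E3 :=
  !₂[a 1 * b 2 - a 2 * b 1, a 2 * b 0 - a 0 * b 2, a 0 * b 1 - a 1 * b 0]

/-- The unit normal of a parametrized surface. -/
def unitNormal (Y : ℂ → E3) (z : ℂ) : E3 :=
  (1 / ‖cross (dx Y z) (dy Y z)‖) • cross (dx Y z) (dy Y z)

/-- The determinant `E G - F²` of the first fundamental form. -/
def firstFormDet (Y : ℂ → E3) (z : ℂ) : ℝ :=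
  ‖dx Y z‖ ^ 2 * ‖dy Y z‖ ^ 2 - (inner ℝ (dx Y z) (dy Y z)) ^ 2

/-- The determinant of the second fundamental form. -/
def secondFormDet (Y : ℂ → E3) (z : ℂ) : ℝ :=
  inner ℝ (dx (dx Y) z) (unitNormal Y z) * inner ℝ (dy (dy Y) z) (unitNormal Y z)
    - (inner ℝ (dx (dy Y) z) (unitNormal Y z)) ^ 2

/-- The Gaussian curvature, i.e. the determinant of the shape operator. -/
def gaussCurvature (Y : ℂ → E3) (z : ℂ) : ℝ := secondFormDet Y z / firstFormDet Y z

/-- The density of the area element with respect to `dx dy`. -/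
def areaDensity (Y : ℂ → E3) (z : ℂ) : ℝ := Real.sqrt (firstFormDet Y z)

/-- The puncture `p` is a planar end of the surface `Y`: after a linear isometry of `ℝ³`, a
punctured neighbourhood of `p` is a graph over the exterior of a disk in the `(x₁, x₂)`-plane, with
height function `b + (c₁ x₁ + c₂ x₂) / r² + O(r⁻²)` (no logarithmic term), and `r → ∞` at `p`. -/
def IsPlanarEnd (Y : ℂ → E3) (p : ℂ) : Prop :=
  ∃ (T : E3 ≃ₗᵢ[ℝ] E3) (U : Set ℂ) (R b c₁ c₂ C : ℝ),
    IsOpen U ∧ p ∈ U ∧ 0 < R ∧ ContinuousOn Y (U \ {p}) ∧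
    BijOn (fun z => (T (Y z) 0, T (Y z) 1)) (U \ {p})
      {s : ℝ × ℝ | R ^ 2 < s.1 ^ 2 + s.2 ^ 2} ∧
    (∀ z ∈ U \ {p}, |T (Y z) 2 -
        (b + (c₁ * T (Y z) 0 + c₂ * T (Y z) 1) / (T (Y z) 0 ^ 2 + T (Y z) 1 ^ 2))|
      ≤ C / (T (Y z) 0 ^ 2 + T (Y z) 1 ^ 2)) ∧
    Tendsto (fun z => T (Y z) 0 ^ 2 + T (Y z) 1 ^ 2) (𝓝[≠] p) atTop

end ParametrizedSurfaces

/-- `Λ` is a lattice in `ℂ`, so that `ℂ / Λ` is a torus. -/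
def IsLatticeInC (Λ : AddSubgroup ℂ) : Prop :=
  DiscreteTopology Λ ∧ Submodule.span ℝ (Λ : Set ℂ) = ⊤

/-- The smallest orientable quotient of the surface `X` is a properly immersed minimal torus with
two planar ends in `ℝ³ / ⟨v⟩`, and its total curvature is `κ`. -/
def QuotientIsTwoEndedTorus (g : Cyl → ℂ) (X : Cyl → E3) (v : E3) (κ : ℝ) : Prop :=
  ∃ (Λ : AddSubgroup ℂ) (p q : ℂ), IsLatticeInC Λ ∧ (p : ℂ ⧸ Λ) ≠ (q : ℂ ⧸ Λ) ∧
    -- the quotient is the torus `ℂ / Λ` minus two points, with `z` as a conformal coordinate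
    (∃ ψ : OrientableQuotient g X ≃ₜ {t : ℂ ⧸ Λ // t ≠ (p : ℂ ⧸ Λ) ∧ t ≠ (q : ℂ ⧸ Λ)},
      ∀ (z : ℂ) (hz : (z : Cyl) ∈ puncturedCyl g),
        (ψ (Quotient.mk (translationSetoid g X) ⟨(z : Cyl), hz⟩) : ℂ ⧸ Λ) = (z : ℂ ⧸ Λ)) ∧
    -- `X` descends to a proper map into `ℝ³ / ⟨v⟩`
    (∃ Xbar : OrientableQuotient g X → E3 ⧸ AddSubgroup.zmultiples v,
      (∀ x : puncturedCyl g, Xbar (Quotient.mk (translationSetoid g X) x) =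
        ((X x : E3) : E3 ⧸ AddSubgroup.zmultiples v)) ∧ IsProperMap Xbar) ∧
    -- which is a minimal immersion
    (∀ z : ℂ, (z : ℂ ⧸ Λ) ≠ (p : ℂ ⧸ Λ) → (z : ℂ ⧸ Λ) ≠ (q : ℂ ⧸ Λ) →
      IsMinimalImmersionAt (lift X) z) ∧
    -- whose two ends are planar
    IsPlanarEnd (lift X) p ∧ IsPlanarEnd (lift X) q ∧
    -- the integral of `K dA` over the quotient, computed on any fundamental domain of `Λ`, is `κ`
    (∀ F : Set ℂ, IsAddFundamentalDomain Λ F volume →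
      IntegrableOn (fun z => gaussCurvature (lift X) z * areaDensity (lift X) z) F ∧
      ∫ z in F, gaussCurvature (lift X) z * areaDensity (lift X) z = κ)

end RiemannType

end

/-! Write `f` for the lift of `g`. Multiplying the identity S = ⟨N, a⟩ by 1 + |f|² turns it into a
relation ∑ F_k(z) conj(H_k(z)) = 0 with holomorphic F_k, H_k. By `polarization` the two arguments
may be varied independently. Freezing the second one at two points where `f` differs gives two
linear equations, and eliminating the second derivative from them leaves f'² = β f + c f² + e f³
(`exists_ode_of_shiffman`).

From here on the argument concerns elliptic functions, without the ℘-function. The differentiated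
equation has a unique solution for given initial values. At every double zero the initial values are
(0, 0), so any two zeros differ by a period and `f` is symmetric about each zero; passing to 1/f
gives the same for poles. Infinitely many zeros on the cylinder then force a period off the
imaginary axis, so the period group L is a lattice. The uniqueness also shows that `f` takes each
value at most twice modulo L (`DoubleElliptic.mem_of_apply_eq`).

A symmetry of M that preserves N preserves `f`, so at each point it is a translation by a period or
a point reflection. The third coordinate of X is Re z up to a constant, which confines reflections
to countably many vertical lines; hence the symmetries are exactly the translations by L
(`IsOrientedTranslation.exists_period`). Their vectors depend only on the real part of the period,
and the real parts of L form a cyclic group (`exists_generator`).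

The quotient is therefore ℂ / L minus one zero class and one pole class. The symmetry of `f` at
these points makes the Laurent expansions even, so no logarithm occurs and both ends are planar
(`isPlanarEnd_zero`, `isPlanarEnd_pole`). Planarity, with v not horizontal, gives properness.
Finally K dA is minus the pullback of the spherical area, and half of a fundamental parallelogram
covers the sphere once up to null sets, so the total is -2 · 4π. -/

/-! ### Identity and uniqueness principles. -/

/-- Identity theorem for meromorphic functions on the plane. -/
theorem eventuallyEq_nhdsNE_of_eventuallyEq {f h : ℂ → ℂ} (hf : MeromorphicOn f univ)
    (hh : MeromorphicOn h univ) {a : ℂ} (hE : f =ᶠ[𝓝[≠] a] h) (b : ℂ) : f =ᶠ[𝓝[≠] b] h := by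
  have hd : MeromorphicOn (f - h) univ := hf.sub hh
  have key : meromorphicOrderAt (f - h) b = ⊤ := by
    by_contra hb
    have := MeromorphicOn.meromorphicOrderAt_ne_top_of_isPreconnected (y := a) hd
      isPreconnected_univ (mem_univ b) (mem_univ a) hb
    apply this
    rw [meromorphicOrderAt_eq_top_iff]
    filter_upwards [hE] with z hz
    simp [hz]
  rw [meromorphicOrderAt_eq_top_iff] at key
  filter_upwards [key] with z hz
  exact sub_eq_zero.1 hz

theorem MeromorphicNFOn.eq_of_eventuallyEq {f h : ℂ → ℂ} (hf : MeromorphicNFOn f univ)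
    (hh : MeromorphicNFOn h univ) {a : ℂ} (hE : f =ᶠ[𝓝[≠] a] h) : f = h := by
  funext b
  have := eventuallyEq_nhdsNE_of_eventuallyEq hf.meromorphicOn hh.meromorphicOn hE b
  rw [(hf (mem_univ b)).eventuallyEq_nhdsNE_iff_eventuallyEq_nhds (hh (mem_univ b))] at this
  exact this.eq_of_nhds

/-- A solution of `d'' = k d` with vanishing initial values vanishes. -/
theorem eventually_eq_zero_of_deriv_deriv_eq_mul {d k : ℂ → ℂ} {a : ℂ} (hd : AnalyticAt ℂ d a)
    (hk : AnalyticAt ℂ k a) (hE : ∀ᶠ z in 𝓝 a, deriv (deriv d) z = k z * d z)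
    (h0 : d a = 0) (h1 : deriv d a = 0) : ∀ᶠ z in 𝓝 a, d z = 0 := by
  rw [← analyticOrderAt_eq_top]
  have e1 := hd.analyticOrderAt_deriv_add_one
  have e2 := hd.deriv.analyticOrderAt_deriv_add_one
  rw [h0] at e1
  rw [h1] at e2
  simp only [sub_zero] at e1 e2
  -- Two differentiations lower the order of `d` by two, while the equation says that d'' vanishes
  -- at least to the order of `d`; only infinite order survives.
  have e3 : analyticOrderAt (deriv (deriv d)) a = analyticOrderAt k a + analyticOrderAt d a := by
    rw [← analyticOrderAt_mul hk hd]
    exact analyticOrderAt_congr hE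
  by_contra hne
  have : analyticOrderAt d a + 2 ≤ analyticOrderAt d a := by
    calc analyticOrderAt d a + 2 ≤ (analyticOrderAt k a + analyticOrderAt d a) + 1 + 1 := by
          rw [add_assoc (analyticOrderAt k a + analyticOrderAt d a), one_add_one_eq_two]
          gcongr
          exact le_add_self
      _ = analyticOrderAt d a := by rw [← e3, e2, e1]
  lift analyticOrderAt d a to ℕ using hne with n
  norm_cast at this
  omega

/-! ### The second order equation and its invariances. -/

/-- The function `f` solves `2 y'' = β + 2 c y + 3 e y²` (off its poles). -/
def SolvesODE (β c e : ℂ) (f : ℂ → ℂ) : Prop :=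
  ∀ a, ∀ᶠ z in 𝓝[≠] a, 2 * deriv (deriv f) z = β + 2 * c * f z + 3 * e * f z ^ 2

theorem SolvesODE.eventually_nhds {β c e : ℂ} {f : ℂ → ℂ} (h : SolvesODE β c e f) {a : ℂ}
    (hf : AnalyticAt ℂ f a) :
    ∀ᶠ z in 𝓝 a, 2 * deriv (deriv f) z = β + 2 * c * f z + 3 * e * f z ^ 2 := by
  have h1 : AnalyticAt ℂ (fun z => 2 * deriv (deriv f) z) a :=
    analyticAt_const.mul hf.deriv.deriv
  have h2 : AnalyticAt ℂ (fun z => β + 2 * c * f z + 3 * e * f z ^ 2) a := by fun_prop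
  exact (h1.frequently_eq_iff_eventually_eq h2).1 (h a).frequently

theorem SolvesODE.eq_of_initial {β c e : ℂ} {f h : ℂ → ℂ} (hf : MeromorphicNFOn f univ)
    (hh : MeromorphicNFOn h univ) (hfo : SolvesODE β c e f) (hho : SolvesODE β c e h) {a : ℂ}
    (hfa : AnalyticAt ℂ f a) (hha : AnalyticAt ℂ h a) (h0 : f a = h a)
    (h1 : deriv f a = deriv h a) : f = h := by
  apply hf.eq_of_eventuallyEq hh (a := a)
  apply Filter.EventuallyEq.filter_mono _ nhdsWithin_le_nhds
  have hd1 : ∀ᶠ z in 𝓝 a, deriv (fun w => f w - h w) z = deriv f z - deriv h z := by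
    filter_upwards [hfa.eventually_analyticAt, hha.eventually_analyticAt] with z hz1 hz2
    exact deriv_fun_sub hz1.differentiableAt hz2.differentiableAt
  -- Subtracting the two equations and factoring f² - h² shows that the difference solves a linear
  -- equation with this coefficient.
  have key := eventually_eq_zero_of_deriv_deriv_eq_mul (d := fun w => f w - h w)
    (k := fun z => c + 3 / 2 * e * (f z + h z)) (a := a) (by fun_prop) (by fun_prop) ?_
    (by simp [h0]) (by rw [hd1.self_of_nhds, h1, sub_self])
  · filter_upwards [key] with z hz using sub_eq_zero.1 hz
  · filter_upwards [hd1.eventually_nhds, hfo.eventually_nhds hfa, hho.eventually_nhds hha,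
      hfa.deriv.eventually_analyticAt, hha.deriv.eventually_analyticAt] with z h1 h2 h3 h4 h5
    have e1 : deriv (deriv fun w => f w - h w) z = deriv (fun w => deriv f w - deriv h w) z :=
      Filter.EventuallyEq.deriv_eq h1
    rw [e1, deriv_fun_sub h4.differentiableAt h5.differentiableAt]
    linear_combination (1/2) * h2 - (1/2) * h3

theorem SolvesODE.comp_add {β c e : ℂ} {f : ℂ → ℂ} (h : SolvesODE β c e f) (l : ℂ) :
    SolvesODE β c e (fun z => f (z + l)) := by
  intro a
  have h1 : deriv (fun z => f (z + l)) = fun z => deriv f (z + l) := by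
    funext z; exact deriv_comp_add_const ..
  have h2 : deriv (fun z => deriv f (z + l)) = fun z => deriv (deriv f) (z + l) := by
    funext z; exact deriv_comp_add_const ..
  rw [h1, h2]
  have ht : Tendsto (fun z => z + l) (𝓝[≠] a) (𝓝[≠] (a + l)) := by
    apply tendsto_nhdsWithin_of_tendsto_nhds_of_eventually_within
    · exact (continuous_add_const l).continuousAt.tendsto.mono_left nhdsWithin_le_nhds
    · filter_upwards [self_mem_nhdsWithin] with z hz
      simpa using hz
  exact ht.eventually (h (a + l))

theorem SolvesODE.comp_neg {β c e : ℂ} {f : ℂ → ℂ} (h : SolvesODE β c e f) :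
    SolvesODE β c e (fun z => f (-z)) := by
  intro a
  have h1 : deriv (fun z => f (-z)) = fun z => -deriv f (-z) := by
    funext z; exact deriv_comp_neg ..
  have h2 : deriv (fun z => -deriv f (-z)) = fun z => deriv (deriv f) (-z) := by
    funext z
    rw [deriv.fun_neg, deriv_comp_neg, neg_neg]
  rw [h1, h2]
  have ht : Tendsto (fun z => -z) (𝓝[≠] a) (𝓝[≠] (-a)) := by
    apply tendsto_nhdsWithin_of_tendsto_nhds_of_eventually_within
    · exact continuous_neg.continuousAt.tendsto.mono_left nhdsWithin_le_nhds
    · filter_upwards [self_mem_nhdsWithin] with z hz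
      simpa using hz
  exact ht.eventually (h (-a))

theorem SolvesODE.comp_const_sub {β c e : ℂ} {f : ℂ → ℂ} (h : SolvesODE β c e f) (l : ℂ) :
    SolvesODE β c e (fun z => f (l - z)) := by
  have := (h.comp_add l).comp_neg
  simpa [neg_add_eq_sub] using this

theorem MeromorphicNFOn.comp_add {f : ℂ → ℂ} (h : MeromorphicNFOn f univ) (l : ℂ) :
    MeromorphicNFOn (fun z => f (z + l)) univ := fun z _ =>
  (h (mem_univ (z + l))).comp_analyticAt (g := fun z => z + l) (by fun_prop)

theorem MeromorphicNFOn.comp_const_sub {f : ℂ → ℂ} (h : MeromorphicNFOn f univ) (l : ℂ) :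
    MeromorphicNFOn (fun z => f (l - z)) univ := fun z _ =>
  (h (mem_univ (l - z))).comp_analyticAt (g := fun z => l - z) (by fun_prop)

/-- A nonconstant solution of `y'² = β y + c y² + e y³` solves the second order equation. -/
theorem solvesODE_of_sq {β c e : ℂ} {f : ℂ → ℂ} (hf : MeromorphicOn f univ)
    (hsq : ∀ a, ∀ᶠ z in 𝓝[≠] a, deriv f z ^ 2 = β * f z + c * f z ^ 2 + e * f z ^ 3)
    (hne : ∀ a, ∀ᶠ z in 𝓝[≠] a, deriv f z ≠ 0) : SolvesODE β c e f := by
  intro a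
  filter_upwards [eventually_eventually_nhdsWithin.2 (hsq a), hne a,
    (hf a (mem_univ a)).eventually_analyticAt,
    self_mem_nhdsWithin] with z h1 h2 h3 h4
  have h1' : ∀ᶠ w in 𝓝 z, deriv f w ^ 2 = β * f w + c * f w ^ 2 + e * f w ^ 3 := by
    rwa [(isOpen_compl_singleton.nhdsWithin_eq (mem_compl_singleton_iff.2 h4))] at h1
  have h5 := h3.deriv.differentiableAt.hasDerivAt.pow 2
  have h6 := ((h3.differentiableAt.hasDerivAt.const_mul β).add
    ((h3.differentiableAt.hasDerivAt.pow 2).const_mul c)).add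
    ((h3.differentiableAt.hasDerivAt.pow 3).const_mul e)
  have h7 := h5.unique (h6.congr_of_eventuallyEq h1')
  simp only [Nat.cast_ofNat] at h7
  -- Differentiating the first order equation gives the claim multiplied by f', which is nonzero
  -- here.
  apply mul_right_cancel₀ h2
  norm_num at h7
  linear_combination h7

/-! ### Elliptic functions with double zeros and poles. -/

/-- A nonconstant meromorphic function with `y'² = β y + c y² + e y³`, all of whose zeros and poles
are double. -/
structure DoubleElliptic (β c e : ℂ) (f : ℂ → ℂ) : Prop where
  nf : MeromorphicNFOn f univ
  order : ∀ z, meromorphicOrderAt f z = 0 ∨ meromorphicOrderAt f z = 2 ∨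
    meromorphicOrderAt f z = -2
  exists_zero : ∃ z, meromorphicOrderAt f z = 2
  exists_pole : ∃ z, meromorphicOrderAt f z = -2
  sq : ∀ a, ∀ᶠ z in 𝓝[≠] a, deriv f z ^ 2 = β * f z + c * f z ^ 2 + e * f z ^ 3

namespace DoubleElliptic
variable {β c e : ℂ} {f : ℂ → ℂ}

theorem order_ne_top (h : DoubleElliptic β c e f) (z : ℂ) : meromorphicOrderAt f z ≠ ⊤ := by
  rcases h.order z with h | h | h <;> rw [h] <;> exact WithTop.coe_ne_top

/-- The substitution y ↦ 1/y preserves the shape of the equation and exchanges its outer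
coefficients, so results about zeros transfer to poles. -/
theorem inv (h : DoubleElliptic β c e f) : DoubleElliptic e c β f⁻¹ := by
  refine ⟨meromorphicNFOn_inv.2 h.nf, fun z => ?_, ?_, ?_, fun a => ?_⟩
  · rw [meromorphicOrderAt_inv]
    rcases h.order z with h | h | h <;> simp [h]
  · obtain ⟨z, hz⟩ := h.exists_pole
    exact ⟨z, by rw [meromorphicOrderAt_inv, hz]; decide⟩
  · obtain ⟨z, hz⟩ := h.exists_zero
    exact ⟨z, by rw [meromorphicOrderAt_inv, hz]⟩
  · have hm := h.nf.meromorphicOn a (mem_univ a)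
    filter_upwards [h.sq a, hm.eventually_analyticAt,
      (meromorphicOrderAt_ne_top_iff_eventually_ne_zero hm).1 (h.order_ne_top a)] with z h1 h2 h3
    rw [deriv_inv'' h2.differentiableAt h3]
    simp only [Pi.inv_apply]
    field_simp
    rw [h1]
    ring

/-- At a double zero f' has order exactly one, so it is not identically zero; the identity theorem
does the rest. -/
theorem deriv_ne_zero (h : DoubleElliptic β c e f) (a : ℂ) : ∀ᶠ z in 𝓝[≠] a, deriv f z ≠ 0 := by
  obtain ⟨p, hp⟩ := h.exists_zero
  rw [← meromorphicOrderAt_ne_top_iff_eventually_ne_zero (h.nf.meromorphicOn a (mem_univ a)).deriv]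
  have hd : MeromorphicOn (deriv f) univ := h.nf.meromorphicOn.deriv
  have : meromorphicOrderAt (deriv f) p = ((2 - 1 : ℤ) : WithTop ℤ) :=
    meromorphicOrderAt_deriv_eq_sub_one (by norm_num) hp
  exact hd.meromorphicOrderAt_ne_top_of_isPreconnected isPreconnected_univ (mem_univ p)
    (mem_univ a) (by rw [this]; exact WithTop.coe_ne_top)

theorem solvesODE (h : DoubleElliptic β c e f) : SolvesODE β c e f :=
  solvesODE_of_sq h.nf.meromorphicOn h.sq h.deriv_ne_zero

theorem analyticAt (h : DoubleElliptic β c e f) {a : ℂ} (ha : 0 ≤ meromorphicOrderAt f a) :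
    AnalyticAt ℂ f a :=
  (h.nf (mem_univ a)).meromorphicOrderAt_nonneg_iff_analyticAt.1 ha

theorem sq_eq (h : DoubleElliptic β c e f) {a : ℂ} (ha : 0 ≤ meromorphicOrderAt f a) :
    deriv f a ^ 2 = β * f a + c * f a ^ 2 + e * f a ^ 3 := by
  have hf := h.analyticAt ha
  have h1 : AnalyticAt ℂ (fun z => deriv f z ^ 2) a := hf.deriv.pow 2
  have h2 : AnalyticAt ℂ (fun z => β * f z + c * f z ^ 2 + e * f z ^ 3) a := by fun_prop
  exact ((h1.frequently_eq_iff_eventually_eq h2).1 (h.sq a).frequently).self_of_nhds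

theorem ne_zero_iff (h : DoubleElliptic β c e f) {a : ℂ} : f a ≠ 0 ↔ meromorphicOrderAt f a = 0 :=
  (h.nf (mem_univ a)).meromorphicOrderAt_eq_zero_iff.symm

theorem apply_zero (h : DoubleElliptic β c e f) {a : ℂ} (ha : meromorphicOrderAt f a = 2) :
    f a = 0 := by
  by_contra h0
  rw [h.ne_zero_iff.1 h0] at ha
  revert ha; decide

theorem deriv_zero (h : DoubleElliptic β c e f) {a : ℂ} (ha : meromorphicOrderAt f a = 2) :
    deriv f a = 0 := by
  have := h.sq_eq (a := a) (by rw [ha]; decide)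
  rw [h.apply_zero ha] at this
  simpa using this

end DoubleElliptic

/-! ### Periods and reflections. -/

/-- The group of periods of a function on the plane. -/
def periodGroup {α : Type*} (f : ℂ → α) : AddSubgroup ℂ where
  carrier := {l | ∀ z, f (z + l) = f z}
  zero_mem' := by simp
  add_mem' := by
    intro a b ha hb z
    rw [← add_assoc, hb, ha]
  neg_mem' := by
    intro a ha z
    rw [← ha (z + -a), neg_add_cancel_right]

theorem mem_periodGroup {α : Type*} {f : ℂ → α} {l : ℂ} :
    l ∈ periodGroup f ↔ ∀ z, f (z + l) = f z := Iff.rfl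

theorem deriv_add_period {f : ℂ → ℂ} {l : ℂ} (hl : l ∈ periodGroup f) (z : ℂ) :
    deriv f (z + l) = deriv f z := by
  conv_rhs => rw [show f = fun w => f (w + l) from funext fun w => (hl w).symm]
  rw [deriv_comp_add_const]

theorem meromorphicOrderAt_add_period {f : ℂ → ℂ} {l : ℂ} (hl : l ∈ periodGroup f) (z : ℂ) :
    meromorphicOrderAt f (z + l) = meromorphicOrderAt f z := by
  rw [← meromorphicOrderAt_comp_add_const_eq_meromorphicOrderAt]
  congr 1
  funext w
  exact hl w

theorem meromorphicOrderAt_comp_const_sub (f : ℂ → ℂ) (l z : ℂ) :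
    meromorphicOrderAt (fun w => f (l - w)) z = meromorphicOrderAt f (l - z) := by
  refine meromorphicOrderAt_comp_of_deriv_ne_zero (f := f) (g := fun w => l - w) (by fun_prop) ?_
  simp

namespace DoubleElliptic
variable {β c e : ℂ} {f : ℂ → ℂ}

/-- The reflected function solves the same equation and also has initial values (0, 0) at `p`. -/
theorem reflection (h : DoubleElliptic β c e f) {p : ℂ} (hp : meromorphicOrderAt f p = 2) (z : ℂ) :
    f (2 * p - z) = f z := by
  have hfa : AnalyticAt ℂ f p := h.analyticAt (by rw [hp]; decide)
  have e1 : 2 * p - p = p := by ring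
  refine congrFun (SolvesODE.eq_of_initial (a := p) (h.nf.comp_const_sub (2 * p)) h.nf
    (h.solvesODE.comp_const_sub _) h.solvesODE ?_ hfa ?_ ?_) z
  · refine AnalyticAt.comp (g := f) (by rwa [e1]) (by fun_prop)
  · simp only [e1]
  · rw [deriv_comp_const_sub, e1, h.deriv_zero hp, neg_zero]

/-- The initial values at every double zero are (0, 0), so moving one zero to another gives the same
solution. -/
theorem sub_mem_of_zeros (h : DoubleElliptic β c e f) {p q : ℂ} (hp : meromorphicOrderAt f p = 2)
    (hq : meromorphicOrderAt f q = 2) : q - p ∈ periodGroup f := by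
  have hpa : AnalyticAt ℂ f p := h.analyticAt (by rw [hp]; decide)
  have hqa : AnalyticAt ℂ f q := h.analyticAt (by rw [hq]; decide)
  intro z
  have e1 : p + (q - p) = q := by ring
  refine congrFun (SolvesODE.eq_of_initial (a := p) (h.nf.comp_add (q - p)) h.nf
    (h.solvesODE.comp_add _) h.solvesODE ?_ hpa ?_ ?_) z
  · exact AnalyticAt.comp (g := f) (by rwa [e1]) (by fun_prop)
  · simp only [e1, h.apply_zero hp, h.apply_zero hq]
  · rw [deriv_comp_add_const, e1, h.deriv_zero hp, h.deriv_zero hq]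

theorem periodGroup_inv : periodGroup f⁻¹ = periodGroup f := by
  ext l
  simp [mem_periodGroup]

theorem sub_mem_of_poles (h : DoubleElliptic β c e f) {p q : ℂ} (hp : meromorphicOrderAt f p = -2)
    (hq : meromorphicOrderAt f q = -2) : q - p ∈ periodGroup f := by
  rw [← periodGroup_inv]
  apply h.inv.sub_mem_of_zeros <;> rw [meromorphicOrderAt_inv] <;> simp only [hp, hq] <;> decide

/-- The function takes each value at most twice, modulo periods. -/
theorem mem_of_apply_eq (h : DoubleElliptic β c e f) {p z w : ℂ} (hp : meromorphicOrderAt f p = 2)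
    (hz : 0 ≤ meromorphicOrderAt f z) (hw : 0 ≤ meromorphicOrderAt f w) (hE : f z = f w) :
    w - z ∈ periodGroup f ∨ z + w - 2 * p ∈ periodGroup f := by
  have hza := h.analyticAt hz
  have hwa := h.analyticAt hw
  have h1 := h.sq_eq hz
  rw [hE, ← h.sq_eq hw, sq_eq_sq_iff_eq_or_eq_neg] at h1
  -- Equal values have derivatives equal up to sign: equal derivatives lead to a translation,
  -- opposite ones to the reflection exchanging `z` and `w`.
  rcases h1 with h1 | h1
  · left
    intro x
    have e1 : z + (w - z) = w := by ring
    refine congrFun (SolvesODE.eq_of_initial (a := z) (h.nf.comp_add (w - z)) h.nf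
      (h.solvesODE.comp_add _) h.solvesODE ?_ hza ?_ ?_) x
    · exact AnalyticAt.comp (g := f) (by rwa [e1]) (by fun_prop)
    · simp only [e1, hE]
    · rw [deriv_comp_add_const, e1, h1]
  · right
    have e1 : z + w - z = w := by ring
    have : (fun x => f (z + w - x)) = f := by
      refine SolvesODE.eq_of_initial (a := z) (h.nf.comp_const_sub (z + w)) h.nf
        (h.solvesODE.comp_const_sub _) h.solvesODE ?_ hza ?_ ?_
      · exact AnalyticAt.comp (g := f) (by rwa [e1]) (by fun_prop)
      · simp only [e1, hE]
      · rw [deriv_comp_const_sub, e1, h1]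
    -- The reflection maps the zero `p` to another zero, so it agrees modulo periods with the
    -- reflection about `p`.
    have h2 : meromorphicOrderAt f (z + w - p) = 2 := by
      rw [← meromorphicOrderAt_comp_const_sub, this, hp]
    have := h.sub_mem_of_zeros hp h2
    rwa [show z + w - p - p = z + w - 2 * p by ring] at this

theorem zero_iff (h : DoubleElliptic β c e f) {p : ℂ} (hp : meromorphicOrderAt f p = 2) {z : ℂ} :
    meromorphicOrderAt f z = 2 ↔ z - p ∈ periodGroup f := by
  refine ⟨fun hz => h.sub_mem_of_zeros hp hz, fun hz => ?_⟩
  rw [← hp, ← meromorphicOrderAt_add_period hz p, add_sub_cancel]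

theorem pole_iff (h : DoubleElliptic β c e f) {p : ℂ} (hp : meromorphicOrderAt f p = -2) {z : ℂ} :
    meromorphicOrderAt f z = -2 ↔ z - p ∈ periodGroup f := by
  refine ⟨fun hz => h.sub_mem_of_poles hp hz, fun hz => ?_⟩
  rw [← hp, ← meromorphicOrderAt_add_period hz p, add_sub_cancel]

/-- If l is a period, p + l is again a zero, and the zeros of `f` are isolated. -/
theorem discreteTopology (h : DoubleElliptic β c e f) : DiscreteTopology (periodGroup f) := by
  obtain ⟨p, hp⟩ := h.exists_zero
  have hm := h.nf.meromorphicOn p (mem_univ p)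
  have h1 := (meromorphicOrderAt_ne_top_iff_eventually_ne_zero hm).1 (h.order_ne_top p)
  rw [eventually_nhdsWithin_iff, ← map_add_left_nhds_zero p, eventually_map] at h1
  apply discreteTopology_of_isOpen_singleton_zero
  obtain ⟨U, hU, hUo, h0⟩ := eventually_nhds_iff.1 h1
  refine isOpen_induced_iff.2 ⟨U, hUo, ?_⟩
  ext ⟨l, hl⟩
  simp only [mem_preimage, mem_singleton_iff, AddSubgroup.mk_eq_zero]
  refine ⟨fun hlU => ?_, fun h => h ▸ h0⟩
  by_contra hne
  exact hU l hlU (by simpa using hne) (by rw [hl p, h.apply_zero hp])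

end DoubleElliptic

/-! ### Discrete subgroups of ℂ containing i. -/

section Lattice

theorem AddSubgroup.sub_floor_mem {L : AddSubgroup ℂ} (hI : Complex.I ∈ L) {l : ℂ} (hl : l ∈ L) :
    l - (⌊l.im⌋ : ℤ) • Complex.I ∈ L :=
  L.sub_mem hl (L.zsmul_mem hI _)

variable {L : AddSubgroup ℂ} [DiscreteTopology L]

theorem AddSubgroup.finite_inter_of_isBounded {B : Set ℂ} (hB : Bornology.IsBounded B) :
    (B ∩ (L : Set ℂ)).Finite :=
  Metric.finite_isBounded_inter_isClosed DiscreteTopology.isDiscrete hB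
    AddSubgroup.isClosed_of_discrete

theorem isBounded_rectangle (a b c d : ℝ) :
    Bornology.IsBounded {z : ℂ | z.re ∈ Icc a b ∧ z.im ∈ Icc c d} := by
  have := (Metric.isBounded_Icc a b).reProdIm (Metric.isBounded_Icc c d)
  exact this

theorem sub_floor_re (l : ℂ) : (l - (⌊l.im⌋ : ℤ) • Complex.I).re = l.re := by simp

theorem sub_floor_im (l : ℂ) : (l - (⌊l.im⌋ : ℤ) • Complex.I).im ∈ Icc (0 : ℝ) 1 := by
  have h1 := Int.floor_le l.im
  have h2 := (Int.lt_floor_add_one l.im).le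
  have h3 : (l - (⌊l.im⌋ : ℤ) • Complex.I).im = l.im - ⌊l.im⌋ := by simp
  rw [h3]
  constructor <;> linarith

/-- A family in `L` which is injective modulo `i` leaves the imaginary axis. -/
theorem AddSubgroup.exists_re_ne_zero (hI : Complex.I ∈ L) {ι : Type*} [Infinite ι] (l : ι → ℂ)
    (hl : ∀ j, l j ∈ L) (hinj : ∀ j k, l j - l k ∈ AddSubgroup.zmultiples Complex.I → j = k) :
    ∃ j, (l j).re ≠ 0 := by
  by_contra! hre
  have hfin := L.finite_inter_of_isBounded (isBounded_rectangle 0 0 0 1)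
  -- Subtracting multiples of i moves the whole family into a bounded segment, which meets a
  -- discrete group in finitely many points.
  have hmaps : ∀ j, l j - (⌊(l j).im⌋ : ℤ) • Complex.I ∈
      {z : ℂ | z.re ∈ Icc (0 : ℝ) 0 ∧ z.im ∈ Icc (0 : ℝ) 1} ∩ (L : Set ℂ) := fun j =>
    ⟨⟨by rw [sub_floor_re, hre j]; simp, sub_floor_im _⟩, AddSubgroup.sub_floor_mem hI (hl j)⟩
  have hinj' : Function.Injective fun j => l j - (⌊(l j).im⌋ : ℤ) • Complex.I := by
    intro j k hjk
    apply hinj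
    refine AddSubgroup.mem_zmultiples_iff.2 ⟨⌊(l j).im⌋ - ⌊(l k).im⌋, ?_⟩
    simp only at hjk
    rw [sub_smul]
    linear_combination -hjk
  exact (Set.infinite_of_injective_forall_mem hinj' hmaps) hfin

/-- Otherwise the multiples of `l` would be pairwise distinct modulo i while all staying on the
imaginary axis. -/
theorem AddSubgroup.exists_torsion (hI : Complex.I ∈ L) {l : ℂ} (hl : l ∈ L) (hre : l.re = 0) :
    ∃ (n : ℕ) (m : ℤ), n ≠ 0 ∧ (n : ℤ) • l = m • Complex.I := by
  by_contra hcon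
  push Not at hcon
  have key : ∀ j k : ℕ, k < j → (j : ℤ) • l - (k : ℤ) • l ∉ AddSubgroup.zmultiples Complex.I := by
    intro j k hkj hmem
    obtain ⟨m, hm⟩ := AddSubgroup.mem_zmultiples_iff.1 hmem
    refine hcon (j - k) m (by omega) ?_
    rw [hm, Nat.cast_sub hkj.le, sub_smul]
  have hinj : ∀ j k : ℕ, (j : ℤ) • l - (k : ℤ) • l ∈ AddSubgroup.zmultiples Complex.I → j = k := by
    intro j k hjk
    rcases lt_trichotomy j k with hlt | rfl | hlt
    · refine absurd ?_ (key k j hlt)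
      rw [← neg_mem_iff, neg_sub]
      exact hjk
    · rfl
    · exact absurd hjk (key j k hlt)
  obtain ⟨j, hj⟩ := L.exists_re_ne_zero hI (ι := ℕ) (fun j => (j : ℤ) • l)
    (fun j => L.zsmul_mem hl _) hinj
  simp [hre] at hj

/-- A subgroup of ℝ is dense or cyclic. The real parts cannot be dense: modulo i, elements with real
part in (0, 1) lie in a bounded rectangle, so there are finitely many such real parts. -/
theorem AddSubgroup.exists_re_generator (hI : Complex.I ∈ L) (hre : ∃ l ∈ L, l.re ≠ 0) :
    ∃ l₁ ∈ L, l₁.re ≠ 0 ∧ ∀ l ∈ L, ∃ k : ℤ, l.re = k * l₁.re := by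
  obtain ⟨l, hl, hl0⟩ := hre
  have hS : {x : ℝ | x ∈ L.map Complex.reAddGroupHom ∧ x ∈ Ioo (0 : ℝ) 1}.Finite := by
    refine ((L.finite_inter_of_isBounded (isBounded_rectangle 0 1 0 1)).image Complex.re).subset ?_
    rintro x ⟨⟨m, hm, rfl⟩, hx⟩
    exact ⟨_, ⟨⟨by rw [sub_floor_re]; exact Ioo_subset_Icc_self hx, sub_floor_im _⟩,
      AddSubgroup.sub_floor_mem hI hm⟩, sub_floor_re m⟩
  rcases (L.map Complex.reAddGroupHom).dense_or_cyclic with hd | ⟨a, ha⟩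
  · exfalso
    obtain ⟨x, hx, hx'⟩ := (hd.sdiff_finite hS).inter_open_nonempty (Ioo 0 1) isOpen_Ioo
      (nonempty_Ioo.2 one_pos)
    exact hx'.2 ⟨hx'.1, hx⟩
  · have hmem : ∀ m ∈ L, ∃ k : ℤ, k • a = m.re := fun m hm => by
      have : m.re ∈ L.map Complex.reAddGroupHom := ⟨m, hm, rfl⟩
      rw [ha] at this
      exact AddSubgroup.mem_closure_singleton.1 this
    have haL : a ∈ L.map Complex.reAddGroupHom := by
      rw [ha]; exact AddSubgroup.mem_closure_singleton_self a
    obtain ⟨l₁, hl₁, rfl⟩ := haL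
    refine ⟨l₁, hl₁, ?_, fun m hm => ?_⟩
    · intro h0
      obtain ⟨k, hk⟩ := hmem l hl
      rw [show Complex.reAddGroupHom l₁ = l₁.re from rfl, h0] at hk
      simp at hk
      exact hl0 hk.symm
    · obtain ⟨k, hk⟩ := hmem m hm
      exact ⟨k, by rw [← hk]; simp⟩

theorem span_eq_top_of_re_ne_zero {L : AddSubgroup ℂ} (hI : Complex.I ∈ L)
    (hre : ∃ l ∈ L, l.re ≠ 0) : Submodule.span ℝ (L : Set ℂ) = ⊤ := by
  obtain ⟨l, hl, hl0⟩ := hre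
  rw [eq_top_iff]
  intro z _
  have : z = (z.re / l.re) • l + (z.im - z.re / l.re * l.im) • Complex.I := by
    apply Complex.ext <;> simp
    field_simp
  rw [this]
  exact Submodule.add_mem _ (Submodule.smul_mem _ _ (Submodule.subset_span hl))
    (Submodule.smul_mem _ _ (Submodule.subset_span hI))

end Lattice

/-! ### Polarization and the first order equation. -/

section Polarization
open Metric ComplexConjugate

/-- A holomorphic function on a disk vanishing on the real diameter vanishes. -/
theorem eq_zero_of_real_zero {Φ : ℂ → ℂ} {ρ : ℝ} (hΦ : DifferentiableOn ℂ Φ (ball 0 ρ))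
    (h0 : ∀ x : ℝ, |x| < ρ → Φ x = 0) {z : ℂ} (hz : z ∈ ball (0 : ℂ) ρ) : Φ z = 0 := by
  have hρ : 0 < ρ := pos_of_mem_ball hz
  refine (hΦ.analyticOnNhd isOpen_ball).eqOn_zero_of_preconnected_of_frequently_eq_zero
    (convex_ball 0 ρ).isPreconnected (mem_ball_self hρ) ?_ hz
  have ht : Tendsto (fun x : ℝ => (x : ℂ)) (𝓝[≠] 0) (𝓝[≠] 0) := by
    apply tendsto_nhdsWithin_of_tendsto_nhds_of_eventually_within
    · exact (Complex.continuous_ofReal.tendsto' 0 0 (by simp)).mono_left nhdsWithin_le_nhds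
    · filter_upwards [self_mem_nhdsWithin] with x hx
      simpa using hx
  refine ht.frequently (Eventually.frequently ?_)
  have : ∀ᶠ x : ℝ in 𝓝 0, |x| < ρ := by
    filter_upwards [ball_mem_nhds (0 : ℝ) hρ] with x hx
    simpa using hx
  exact (this.filter_mono nhdsWithin_le_nhds).mono fun x hx => h0 x hx

/-- Polarization of an identity `∑ F_k conj(H_k) = 0` between holomorphic functions. -/
theorem polarization {n : ℕ} {F H : Fin n → ℂ → ℂ} {a : ℂ} {r : ℝ}
    (hF : ∀ k, DifferentiableOn ℂ (F k) (ball a r)) (hH : ∀ k, DifferentiableOn ℂ (H k) (ball a r))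
    (h0 : ∀ z ∈ ball a r, ∑ k, F k z * conj (H k z) = 0) {z w : ℂ} (hz : z ∈ ball a (r / 2))
    (hw : w ∈ ball a (r / 2)) : ∑ k, F k z * conj (H k w) = 0 := by
  -- The double conjugation makes this holomorphic in `s` and in `t` separately. For real `s`, `t`
  -- both arguments equal a + s + i t, where the hypothesis applies; the reality condition is then
  -- removed one variable at a time.
  let Φ : ℂ → ℂ → ℂ := fun s t =>
    ∑ k, F k (a + s + Complex.I * t) * conj (H k (a + conj s + Complex.I * conj t))
  have hball : ∀ s t : ℂ, s ∈ ball (0 : ℂ) (r / 2) → t ∈ ball (0 : ℂ) (r / 2) →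
      a + s + Complex.I * t ∈ ball a r := by
    intro s t hs ht
    rw [mem_ball_zero_iff] at hs ht
    rw [mem_ball_iff_norm]
    calc ‖a + s + Complex.I * t - a‖ = ‖s + Complex.I * t‖ := by ring_nf
      _ ≤ ‖s‖ + ‖t‖ := (norm_add_le _ _).trans (by simp)
      _ < r := by linarith
  have hconj : ∀ s : ℂ, s ∈ ball (0 : ℂ) (r / 2) → conj s ∈ ball (0 : ℂ) (r / 2) := by
    intro s hs
    simpa using hs
  have hdF : ∀ k z, z ∈ ball a r → DifferentiableAt ℂ (F k) z := fun k z hz =>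
    (hF k).differentiableAt (isOpen_ball.mem_nhds hz)
  have hdH : ∀ k z, z ∈ ball a r → DifferentiableAt ℂ (H k) z := fun k z hz =>
    (hH k).differentiableAt (isOpen_ball.mem_nhds hz)
  have step1 : ∀ t : ℝ, |t| < r / 2 → ∀ s ∈ ball (0 : ℂ) (r / 2), Φ s t = 0 := by
    intro t ht s hs
    have ht' : (t : ℂ) ∈ ball (0 : ℂ) (r / 2) := by simpa using ht
    refine eq_zero_of_real_zero (Φ := fun s => Φ s t) (ρ := r / 2) ?_ ?_ hs
    · intro s hs
      refine (DifferentiableAt.fun_sum fun k _ => DifferentiableAt.mul ?_ ?_).differentiableWithinAt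
      · exact DifferentiableAt.comp (g := F k) (f := fun s => a + s + Complex.I * t) s
          (hdF k _ (hball s t hs ht')) (by fun_prop)
      · have := DifferentiableAt.comp (g := H k) (f := fun s => a + s + Complex.I * conj (t : ℂ))
          (conj s) (hdH k _ (hball _ _ (hconj s hs) (hconj t ht'))) (by fun_prop)
        simpa [Function.comp_def] using this.conj_conj
    · intro x hx
      have hx' : (x : ℂ) ∈ ball (0 : ℂ) (r / 2) := by simpa using hx
      simpa [Φ] using h0 _ (hball x t hx' ht')
  have step2 : ∀ s ∈ ball (0 : ℂ) (r / 2), ∀ t ∈ ball (0 : ℂ) (r / 2), Φ s t = 0 := by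
    intro s hs t ht
    refine eq_zero_of_real_zero (Φ := fun t => Φ s t) (ρ := r / 2) ?_
      (fun x hx => step1 x hx s hs) ht
    intro t ht
    refine (DifferentiableAt.fun_sum fun k _ => DifferentiableAt.mul ?_ ?_).differentiableWithinAt
    · exact DifferentiableAt.comp (g := F k) (f := fun t => a + s + Complex.I * t) t
        (hdF k _ (hball s t hs ht)) (by fun_prop)
    · have := DifferentiableAt.comp (g := H k) (f := fun t => a + conj s + Complex.I * t)
        (conj t) (hdH k _ (hball _ _ (hconj s hs) (hconj t ht))) (by fun_prop)
      simpa [Function.comp_def] using this.conj_conj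
  simp only [mem_ball, dist_eq_norm] at hz hw
  -- These values of `s` and `t` make the two arguments equal to `z` and `w`. They stay in the disk
  -- of radius r/2 because `z` and `w` do.
  have hs : ((z - a) + conj (w - a)) / 2 ∈ ball (0 : ℂ) (r / 2) := by
    rw [mem_ball_zero_iff, norm_div, Complex.norm_two]
    have := norm_add_le (z - a) (conj (w - a))
    rw [Complex.norm_conj] at this
    linarith
  have ht : ((z - a) - conj (w - a)) / (2 * Complex.I) ∈ ball (0 : ℂ) (r / 2) := by
    rw [mem_ball_zero_iff, norm_div, norm_mul, Complex.norm_two, Complex.norm_I]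
    have := norm_sub_le (z - a) (conj (w - a))
    rw [Complex.norm_conj] at this
    linarith
  have := step2 _ hs _ ht
  have e1 : a + ((z - a) + conj (w - a)) / 2
      + Complex.I * (((z - a) - conj (w - a)) / (2 * Complex.I)) = z := by
    field_simp
    ring
  have e2 : a + conj (((z - a) + conj (w - a)) / 2)
      + Complex.I * conj (((z - a) - conj (w - a)) / (2 * Complex.I)) = w := by
    simp only [map_div₀, map_add, map_sub, map_mul, Complex.conj_conj, Complex.conj_I, map_ofNat]
    field_simp
    ring
  simpa only [Φ, e1, e2] using this

/-- A function whose Shiffman function is linear solves a first order differential equation. -/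
theorem exists_ode_of_shiffman {f : ℂ → ℂ} {a : ℂ} {r : ℝ} (hf : DifferentiableOn ℂ f (ball a r))
    (hne : ∀ z ∈ ball a r, f z ≠ 0) {w₁ w₂ : ℂ} (hw₁ : w₁ ∈ ball a (r / 2))
    (hw₂ : w₂ ∈ ball a (r / 2)) (hw : f w₁ ≠ f w₂) (a₀ a₁ a₂ : ℝ)
    (h : ∀ z ∈ ball a r, Complex.im ((3 / 2) * (deriv f z / f z) ^ 2 - deriv (deriv f) z / f z
      - (1 / (1 + (‖f z‖ : ℂ) ^ 2)) * (deriv f z / f z) ^ 2) =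
      (1 / (‖f z‖ ^ 2 + 1)) * (2 * (f z).re * a₀ + 2 * (f z).im * a₁ + (‖f z‖ ^ 2 - 1) * a₂)) :
    ∃ β c e : ℂ, ∀ z ∈ ball a (r / 2),
      deriv f z ^ 2 = β * f z + c * f z ^ 2 + e * f z ^ 3 := by
  have hf' : DifferentiableOn ℂ (deriv f) (ball a r) := hf.deriv isOpen_ball
  have hf'' : DifferentiableOn ℂ (deriv (deriv f)) (ball a r) := hf'.deriv isOpen_ball
  set Q : ℂ → ℂ := fun z => (deriv f z / f z) ^ 2 with hQ
  set P : ℂ → ℂ := fun z => (3 / 2) * Q z - deriv (deriv f) z / f z with hP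
  have hQd : DifferentiableOn ℂ Q (ball a r) := (hf'.div hf hne).pow 2
  have hPd : DifferentiableOn ℂ P (ball a r) := (hQd.const_mul _).sub (hf''.div hf hne)
  -- With 2i Im P = P - conj P, the identity multiplied by 2i(1 + |f|²) becomes a sum of four
  -- products; the terms are grouped by their antiholomorphic factors 1, conj f, conj (Q - P) and
  -- -conj (f P).
  let F₀ : ℂ → ℂ := fun z => P z - Q z - 2 * Complex.I * a₀ * f z - 2 * a₁ * f z
      + 2 * Complex.I * a₂
  let F₁ : ℂ → ℂ := fun z => f z * P z - 2 * Complex.I * a₂ * f z - 2 * Complex.I * a₀ + 2 * a₁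
  have hF₀ : DifferentiableOn ℂ F₀ (ball a r) := by fun_prop
  have hF₁ : DifferentiableOn ℂ F₁ (ball a r) := by fun_prop
  let F : Fin 4 → ℂ → ℂ := ![F₀, F₁, fun _ => 1, f]
  let H : Fin 4 → ℂ → ℂ := ![fun _ => 1, f, fun z => Q z - P z, fun z => -(f z * P z)]
  have hFd : ∀ k, DifferentiableOn ℂ (F k) (ball a r) := by
    intro k
    fin_cases k
    exacts [hF₀, hF₁, differentiableOn_const 1, hf]
  have hHd : ∀ k, DifferentiableOn ℂ (H k) (ball a r) := by
    intro k
    fin_cases k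
    exacts [differentiableOn_const 1, hf, hQd.sub hPd, (hf.mul hPd).neg]
  have key : ∀ z ∈ ball a r, ∑ k, F k z * conj (H k z) = 0 := by
    intro z hz
    have h1 := h z hz
    have hm : ‖f z‖ ^ 2 = Complex.normSq (f z) := (Complex.normSq_eq_norm_sq _).symm
    have hm0 : 0 ≤ Complex.normSq (f z) := Complex.normSq_nonneg _
    have hc : (1 / (1 + (‖f z‖ : ℂ) ^ 2)) = (((1 + Complex.normSq (f z))⁻¹ : ℝ) : ℂ) := by
      rw [← hm]; push_cast; simp
    have hE : (1 + Complex.normSq (f z)) * (P z).im - (Q z).im =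
        2 * (f z).re * a₀ + 2 * (f z).im * a₁ + (Complex.normSq (f z) - 1) * a₂ := by
      change (P z - 1 / (1 + (‖f z‖ : ℂ) ^ 2) * Q z).im = _ at h1
      rw [hc, Complex.sub_im, Complex.im_ofReal_mul, hm] at h1
      have h2 : 1 + Complex.normSq (f z) ≠ 0 := by positivity
      rw [add_comm (Complex.normSq (f z)), one_div] at h1
      linear_combination (1 + Complex.normSq (f z)) * h1 + ((Q z).im + 2 * (f z).re * a₀
        + 2 * (f z).im * a₁ + (Complex.normSq (f z) - 1) * a₂) * mul_inv_cancel₀ h2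
    rw [Fin.sum_univ_four]
    change (P z - Q z - 2 * Complex.I * a₀ * f z - 2 * a₁ * f z + 2 * Complex.I * a₂) * conj 1
      + (f z * P z - 2 * Complex.I * a₂ * f z - 2 * Complex.I * a₀ + 2 * a₁) * conj (f z)
      + 1 * conj (Q z - P z) + f z * conj (-(f z * P z)) = 0
    generalize P z = p, Q z = q, f z = x at hE ⊢
    rw [Complex.normSq_apply] at hE
    apply Complex.ext
    · simp
      ring
    · simp
      linear_combination 2 * hE
  have pol : ∀ z ∈ ball a (r / 2), ∀ w ∈ ball a (r / 2),
      (P z - Q z - 2 * Complex.I * a₀ * f z - 2 * a₁ * f z + 2 * Complex.I * a₂) * 1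
      + (f z * P z - 2 * Complex.I * a₂ * f z - 2 * Complex.I * a₀ + 2 * a₁) * conj (f w)
      + 1 * conj (Q w - P w) + f z * conj (-(f w * P w)) = 0 := by
    intro z hz w hw
    have := polarization hFd hHd key hz hw
    rw [Fin.sum_univ_four, show conj (H 0 w) = 1 from map_one _] at this
    exact this
  have hD : conj (f w₁) - conj (f w₂) ≠ 0 := by
    rw [← map_sub]
    exact (map_ne_zero _).2 (sub_ne_zero.2 hw)
  -- Subtracting the polarized relations at w₁ and w₂ expresses f P as an affine function of `f`.
  -- Inserting this in the relation at w₁, multiplied by f², makes f² Q = f'² a cubic in `f` without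
  -- constant term.
  obtain ⟨D, hDdef⟩ : ∃ D, D = conj (f w₁) - conj (f w₂) := ⟨_, rfl⟩
  obtain ⟨k₁, hk₁⟩ : ∃ k, k = conj (Q w₁ - P w₁) - conj (Q w₂ - P w₂) := ⟨_, rfl⟩
  obtain ⟨k₂, hk₂⟩ : ∃ k, k = conj (-(f w₁ * P w₁)) - conj (-(f w₂ * P w₂)) := ⟨_, rfl⟩
  rw [← hDdef] at hD
  refine ⟨2 * Complex.I * a₀ - 2 * a₁ - k₁ / D,
    2 * Complex.I * a₂ - k₂ / D - (k₁ * conj (f w₁) / D - conj (Q w₁ - P w₁) - 2 * Complex.I * a₂),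
    -(k₂ * conj (f w₁) / D - conj (-(f w₁ * P w₁)) + 2 * Complex.I * a₀ + 2 * a₁),
    fun z hz => ?_⟩
  have p₁ := pol z hz w₁ hw₁
  have p₂ := pol z hz w₂ hw₂
  have hB : f z * P z - 2 * Complex.I * a₂ * f z - 2 * Complex.I * a₀ + 2 * a₁ =
      -(k₁ + k₂ * f z) / D := by
    rw [eq_div_iff hD, hDdef, hk₁, hk₂]
    linear_combination p₁ - p₂
  have hfz : f z ≠ 0 := hne z (ball_subset_ball (by linarith [pos_of_mem_ball hz]) hz)
  have hQz : deriv f z ^ 2 = f z ^ 2 * Q z := by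
    simp only [hQ]
    field_simp
  rw [hQz]
  linear_combination f z * hB + f z ^ 2 * conj (f w₁) * hB - f z ^ 2 * p₁

end Polarization

/-! ### From a linear Shiffman function to an elliptic Gauss map. -/

namespace RiemannType
open Metric

variable {g : Cyl → ℂ} {X : Cyl → E3}

theorem coe_eq_coe_iff {z w : ℂ} :
    (z : Cyl) = (w : Cyl) ↔ w - z ∈ AddSubgroup.zmultiples Complex.I := by
  rw [QuotientAddGroup.eq, neg_add_eq_sub]

theorem I_mem_periodGroup {α : Type*} (g : Cyl → α) : Complex.I ∈ periodGroup (lift g) := by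
  intro z
  refine congrArg g (coe_eq_coe_iff.2 ?_)
  rw [sub_add_cancel_left, neg_mem_iff]
  exact AddSubgroup.mem_zmultiples _

theorem zmultiples_le_periodGroup {α : Type*} (g : Cyl → α) :
    AddSubgroup.zmultiples Complex.I ≤ periodGroup (lift g) :=
  (AddSubgroup.zmultiples_le_of_mem (I_mem_periodGroup g))

theorem mem_puncturedCyl {z : ℂ} :
    (z : Cyl) ∈ puncturedCyl g ↔ meromorphicOrderAt (lift g) z = 0 := by
  rw [puncturedCyl, mem_compl_iff, not_iff_comm]
  refine ⟨fun h => ⟨z, rfl, h⟩, ?_⟩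
  rintro ⟨w, hw, h⟩
  rw [coe_eq_coe_iff] at hw
  rwa [← add_sub_cancel w z, meromorphicOrderAt_add_period (zmultiples_le_periodGroup g hw)]

theorem gaussMap_coe (g : Cyl → ℂ) (z : ℂ) : gaussMap g (z : Cyl) =
    if meromorphicOrderAt (lift g) z < 0 then !₂[0, 0, 1] else invStereo (lift g z) := by
  have h1 : lift (fun y => g ((z : Cyl) + y)) = (lift g) ∘ (· + z) := by
    funext w
    simp [lift, add_comm]
  rw [gaussMap, sphereValue, h1, meromorphicOrderAt_comp_add_const_eq_meromorphicOrderAt, zero_add]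
  simp

theorem gaussMap_coe_of_order_eq_zero {z : ℂ} (hz : meromorphicOrderAt (lift g) z = 0) :
    gaussMap g (z : Cyl) = invStereo (lift g z) := by
  rw [gaussMap_coe, if_neg (by simp [hz])]

theorem invStereo_injective : Function.Injective invStereo := by
  intro w w' h
  have h0 := congrFun (congrArg (fun v : E3 => v.ofLp) h) 0
  have h1 := congrFun (congrArg (fun v : E3 => v.ofLp) h) 1
  have h2 := congrFun (congrArg (fun v : E3 => v.ofLp) h) 2
  simp [invStereo] at h0 h1 h2
  have p : 0 < ‖w‖ ^ 2 + 1 := by positivity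
  have p' : 0 < ‖w'‖ ^ 2 + 1 := by positivity
  have h3 : ‖w‖ ^ 2 = ‖w'‖ ^ 2 := by
    field_simp at h2
    linarith
  rw [h3] at h0 h1
  apply Complex.ext
  · have := mul_left_cancel₀ (inv_ne_zero p'.ne') h0
    linarith
  · have := mul_left_cancel₀ (inv_ne_zero p'.ne') h1
    linarith

theorem MemW.order (h : MemW g) (z : ℂ) : meromorphicOrderAt (lift g) z = 0 ∨
    meromorphicOrderAt (lift g) z = 2 ∨ meromorphicOrderAt (lift g) z = -2 := by
  obtain ⟨p, q, -, -, hd⟩ := h.divisor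
  obtain ⟨h1, h2, h3⟩ := hd z
  by_cases hp : (z : Cyl) ∈ range p
  · exact Or.inr (Or.inl (h1 hp))
  by_cases hq : (z : Cyl) ∈ range q
  · exact Or.inr (Or.inr (h2 hq))
  · exact Or.inl (h3 (by simp [hp, hq] at *))

theorem inner_invStereo (w : ℂ) (a : E3) : inner ℝ (invStereo w) a =
    (1 / (‖w‖ ^ 2 + 1)) * (2 * w.re * a 0 + 2 * w.im * a 1 + (‖w‖ ^ 2 - 1) * a 2) := by
  simp [invStereo, PiLp.inner_apply, Fin.sum_univ_three]
  ring

/-- A function in `𝒲` with linear Shiffman function is elliptic. -/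
theorem ShiffmanLinear.doubleElliptic (hW : MemW g) (hS : ShiffmanLinear g) :
    ∃ β c e, DoubleElliptic β c e (lift g) := by
  obtain ⟨p, q, -, -, hd⟩ := hW.divisor
  obtain ⟨z₀, hz₀⟩ := QuotientAddGroup.mk_surjective (p 0)
  obtain ⟨z₁, hz₁⟩ := QuotientAddGroup.mk_surjective (q 0)
  have hz : meromorphicOrderAt (lift g) z₀ = 2 := (hd z₀).1 ⟨0, hz₀.symm⟩
  have hz' : meromorphicOrderAt (lift g) z₁ = -2 := (hd z₁).2.1 ⟨0, hz₁.symm⟩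
  have hnf : MeromorphicNFOn (lift g) univ := hW.quasiperiodic.meromorphic
  have hm : MeromorphicOn (lift g) univ := hnf.meromorphicOn
  set f := lift g with hf
  have hD : ∀ᶠ z in 𝓝[≠] z₀, meromorphicOrderAt f z = 0 := by
    filter_upwards [(meromorphicOrderAt_ne_top_iff_eventually_ne_zero (hm z₀ (mem_univ z₀))).1
      (by rw [hz]; exact WithTop.coe_ne_top)] with z h1
    exact (hnf (mem_univ z)).meromorphicOrderAt_eq_zero_iff.2 h1
  rw [eventually_nhdsWithin_iff, Metric.eventually_nhds_iff_ball] at hD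
  obtain ⟨ε, hε, hD⟩ := hD
  -- A disk with the zero z₀ on its boundary contains neither zeros nor poles.
  obtain ⟨a, ha⟩ : ∃ a, a = z₀ + (ε / 2 : ℝ) := ⟨_, rfl⟩
  have hsub : ∀ z ∈ ball a (ε / 2), meromorphicOrderAt f z = 0 := by
    intro z hza
    rw [mem_ball_iff_norm] at hza
    have hna : ‖a - z₀‖ = ε / 2 := by
      rw [ha, add_sub_cancel_left, Complex.norm_real, Real.norm_of_nonneg (by positivity)]
    refine hD z ?_ ?_
    · rw [mem_ball_iff_norm]
      calc ‖z - z₀‖ = ‖(z - a) + (a - z₀)‖ := by ring_nf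
        _ ≤ ‖z - a‖ + ‖a - z₀‖ := norm_add_le _ _
        _ < ε := by linarith
    · rintro rfl
      rw [norm_sub_rev] at hza
      linarith
  have han : ∀ z ∈ ball a (ε / 2), AnalyticAt ℂ f z := fun z hz =>
    (hnf (mem_univ z)).meromorphicOrderAt_nonneg_iff_analyticAt.1 (hsub z hz).ge
  have hne : ∀ z ∈ ball a (ε / 2), f z ≠ 0 := fun z hz =>
    (hnf (mem_univ z)).meromorphicOrderAt_eq_zero_iff.1 (hsub z hz)
  -- If `f` were constant on the small disk, f' would vanish identically, but it has order one at
  -- the double zero z₀.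
  have hnc : ∃ w₁ ∈ ball a (ε / 2 / 2), ∃ w₂ ∈ ball a (ε / 2 / 2), f w₁ ≠ f w₂ := by
    by_contra! hcon
    have hd0 : meromorphicOrderAt (deriv f) a = ⊤ := by
      rw [meromorphicOrderAt_eq_top_iff]
      refine Filter.Eventually.filter_mono nhdsWithin_le_nhds ?_
      filter_upwards [ball_mem_nhds a (by positivity : 0 < ε / 2 / 2)] with z hz
      have : f =ᶠ[𝓝 z] fun _ => f z := by
        filter_upwards [isOpen_ball.mem_nhds hz] with w hw using hcon w hw z hz
      rw [this.deriv_eq, deriv_const]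
    have h2 : meromorphicOrderAt (deriv f) z₀ = ((2 - 1 : ℤ) : WithTop ℤ) :=
      meromorphicOrderAt_deriv_eq_sub_one (by norm_num) hz
    refine MeromorphicOn.meromorphicOrderAt_ne_top_of_isPreconnected (f := deriv f) (x := z₀)
      hm.deriv
      isPreconnected_univ (mem_univ _) (mem_univ a) ?_ hd0
    rw [h2]; exact WithTop.coe_ne_top
  obtain ⟨w₁, hw₁, w₂, hw₂, hw⟩ := hnc
  obtain ⟨v, hv⟩ := hS
  obtain ⟨β, c, e, hode⟩ := exists_ode_of_shiffman
    (fun z hz => (han z hz).differentiableAt.differentiableWithinAt) hne hw₁ hw₂ hw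
    (v 0) (v 1) (v 2) (fun z hz => by
      rw [← inner_invStereo, ← gaussMap_coe_of_order_eq_zero (hsub z hz),
        ← hv z (mem_puncturedCyl.2 (hsub z hz))]
      rfl)
  refine ⟨β, c, e, hnf, hW.order, ⟨z₀, hz⟩, ⟨z₁, hz'⟩, fun b => ?_⟩
  refine eventuallyEq_nhdsNE_of_eventuallyEq (a := a) (hm.deriv.pow 2)
    (f := fun z => deriv f z ^ 2) (h := fun z => β * f z + c * f z ^ 2 + e * f z ^ 3) ?_ ?_ b
  · intro z _
    have := hm z (mem_univ z)
    fun_prop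
  · refine Filter.EventuallyEq.filter_mono ?_ nhdsWithin_le_nhds
    filter_upwards [ball_mem_nhds a (by positivity : 0 < ε / 2 / 2)] with z hz using hode z hz

/-- The zeros of a function in `𝒲` do not lie on one vertical line. -/
theorem MemW.exists_period_re_ne_zero {β c e : ℂ} (hW : MemW g)
    (h : DoubleElliptic β c e (lift g)) : ∃ l ∈ periodGroup (lift g), l.re ≠ 0 := by
  obtain ⟨p, q, hp, -, hd⟩ := hW.divisor
  choose z hz using fun j => QuotientAddGroup.mk_surjective (p j)
  have hzo : ∀ j, meromorphicOrderAt (lift g) (z j) = 2 := fun j => (hd (z j)).1 ⟨j, (hz j).symm⟩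
  have := h.discreteTopology
  -- The zeros are indexed injectively by ℤ on the cylinder, so their differences are infinitely
  -- many periods distinct modulo i.
  obtain ⟨j, hj⟩ := AddSubgroup.exists_re_ne_zero (I_mem_periodGroup g) (fun j => z j - z 0)
    (fun j => h.sub_mem_of_zeros (hzo 0) (hzo j)) (fun j k hjk => by
      rw [sub_sub_sub_cancel_right, ← coe_eq_coe_iff] at hjk
      apply hp
      rw [← hz j, ← hz k]
      exact hjk.symm)
  exact ⟨_, h.sub_mem_of_zeros (hzo 0) (hzo j), hj⟩

end RiemannType

/-! ### The set of regular points. -/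

namespace DoubleElliptic
variable {β c e : ℂ} {f : ℂ → ℂ}

theorem isOpen_regular (h : DoubleElliptic β c e f) : IsOpen {z | meromorphicOrderAt f z = 0} := by
  rw [isOpen_iff_mem_nhds]
  intro z hz
  have hc := (h.analyticAt (le_of_eq (Eq.symm hz))).continuousAt
  filter_upwards [hc.eventually_ne (h.ne_zero_iff.2 hz)] with w hw
  exact h.ne_zero_iff.1 hw

theorem regular_eq (h : DoubleElliptic β c e f) {p q : ℂ} (hp : meromorphicOrderAt f p = 2)
    (hq : meromorphicOrderAt f q = -2) {z : ℂ} : meromorphicOrderAt f z = 0 ↔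
      z - p ∉ periodGroup f ∧ z - q ∉ periodGroup f := by
  rw [← h.zero_iff hp, ← h.pole_iff hq]
  rcases h.order z with hz | hz | hz <;> rw [hz] <;> decide

theorem countable_periodGroup (h : DoubleElliptic β c e f) :
    (periodGroup f : Set ℂ).Countable := by
  have := h.discreteTopology
  exact TopologicalSpace.separableSpace_iff_countable.1 inferInstance

theorem countable_singular (h : DoubleElliptic β c e f) :
    {z | meromorphicOrderAt f z = 0}ᶜ.Countable := by
  obtain ⟨p, hp⟩ := h.exists_zero
  obtain ⟨q, hq⟩ := h.exists_pole
  refine ((h.countable_periodGroup.image (· + p)).union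
    (h.countable_periodGroup.image (· + q))).mono ?_
  intro z hz
  rw [mem_compl_iff, mem_ofPred_eq, h.regular_eq hp hq] at hz
  by_cases h1 : z - p ∈ periodGroup f
  · exact Or.inl ⟨_, h1, sub_add_cancel _ _⟩
  · exact Or.inr ⟨_, by_contra fun h2 => hz ⟨h1, h2⟩, sub_add_cancel _ _⟩

/-- The complement of a countable subset of the plane is connected. -/
theorem isConnected_regular (h : DoubleElliptic β c e f) :
    IsConnected {z | meromorphicOrderAt f z = 0} := by
  rw [← compl_compl {z | meromorphicOrderAt f z = 0}]
  refine h.countable_singular.isConnected_compl_of_one_lt_rank ?_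
  rw [Complex.rank_real_complex]
  exact Nat.one_lt_ofNat

end DoubleElliptic

/-! ### Translational symmetries. -/

namespace RiemannType
variable {g : Cyl → ℂ} {X : Cyl → E3} {β c e : ℂ}

/-- The points at which the lifted function has neither a zero nor a pole. -/
def regularSet (g : Cyl → ℂ) : Set ℂ := {z | meromorphicOrderAt (lift g) z = 0}

theorem mem_puncturedCyl_iff {z : ℂ} : (z : Cyl) ∈ puncturedCyl g ↔ z ∈ regularSet g :=
  mem_puncturedCyl

theorem add_mem_regularSet {l : ℂ} (hl : l ∈ periodGroup (lift g)) {z : ℂ} :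
    z + l ∈ regularSet g ↔ z ∈ regularSet g := by
  rw [regularSet, mem_ofPred_eq, mem_ofPred_eq, meromorphicOrderAt_add_period hl]

theorem add_mem_puncturedCyl {l : ℂ} (hl : l ∈ periodGroup (lift g)) {x : Cyl} :
    x ∈ puncturedCyl g ↔ x + (l : Cyl) ∈ puncturedCyl g := by
  obtain ⟨z, rfl⟩ := QuotientAddGroup.mk_surjective x
  rw [← QuotientAddGroup.mk_add, mem_puncturedCyl_iff, mem_puncturedCyl_iff,
    add_mem_regularSet hl]

theorem eq_of_hasFDerivAt_zero (h : DoubleElliptic β c e (lift g)) {Y : ℂ → ℝ}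
    (hY : ∀ z ∈ regularSet g, HasFDerivAt Y (0 : ℂ →L[ℝ] ℝ) z) {z w : ℂ} (hz : z ∈ regularSet g)
    (hw : w ∈ regularSet g) : Y z = Y w :=
  h.isOpen_regular.is_const_of_fderiv_eq_zero (𝕜 := ℝ) h.isConnected_regular.isPreconnected
    (fun z hz => (hY z hz).differentiableAt.differentiableWithinAt)
    (fun z hz => (hY z hz).fderiv) hz hw

theorem height_sub (h : DoubleElliptic β c e (lift g)) (hX : HasWeierstrassPair g X) {z w : ℂ}
    (hz : z ∈ regularSet g) (hw : w ∈ regularSet g) :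
    X (z : Cyl) 2 - X (w : Cyl) 2 = z.re - w.re := by
  have := eq_of_hasFDerivAt_zero h (Y := fun z => lift X z 2 - z.re) (fun z hz => ?_) hz hw
  · simp only [lift] at this
    linarith
  · have h1 := (hX z (mem_puncturedCyl_iff.2 hz) 2).sub Complex.reCLM.hasFDerivAt
    convert! h1 using 1
    ext
    simp [weierstrassForm]

/-- The Weierstrass form has the periods of `g`, so X(z + l) - X(z) has zero differential on a
connected set. A single function `w`, defined through one base point, serves all periods, so that
its additivity can be stated later. -/
theorem exists_translation (h : DoubleElliptic β c e (lift g)) (hX : HasWeierstrassPair g X) :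
    ∃ w : ℂ → E3, ∀ l ∈ periodGroup (lift g), (∀ z ∈ regularSet g,
      X ((z + l : ℂ) : Cyl) = X (z : Cyl) + w l) ∧ w l 2 = l.re := by
  obtain ⟨z₀, hz₀⟩ := h.isConnected_regular.nonempty
  refine ⟨fun l => X ((z₀ + l : ℂ) : Cyl) - X (z₀ : Cyl), fun l hl => ⟨fun z hz => ?_, ?_⟩⟩
  · ext j
    have := eq_of_hasFDerivAt_zero h (Y := fun z => lift X (z + l) j - lift X z j)
      (fun z hz => ?_) hz hz₀
    · simp only [lift] at this
      simp only [PiLp.add_apply, PiLp.sub_apply]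
      linarith
    · have h1 := (hasFDerivAt_comp_add_right l).2
        (hX (z + l) (mem_puncturedCyl_iff.2 ((add_mem_regularSet hl).2 hz)) j)
      have h2 := h1.sub (hX z (mem_puncturedCyl_iff.2 hz) j)
      have h3 : weierstrassForm (lift g) (z + l) = weierstrassForm (lift g) z := by
        simp only [weierstrassForm, hl z]
      rw [h3, sub_self] at h2
      exact h2
  · have := height_sub h hX ((add_mem_regularSet hl).2 hz₀) hz₀
    simpa using this

/-- Translation of the punctured cylinder by a period of the Gauss map. -/
noncomputable def periodHomeo {l : ℂ} (hl : l ∈ periodGroup (lift g)) :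
    puncturedCyl g ≃ₜ puncturedCyl g :=
  (Homeomorph.addRight (l : Cyl)).subtype fun _ => add_mem_puncturedCyl hl

theorem coe_periodHomeo {l : ℂ} (hl : l ∈ periodGroup (lift g)) (x : puncturedCyl g) :
    (periodHomeo hl x : Cyl) = x + (l : Cyl) := rfl

theorem isOrientedTranslation_periodHomeo {l : ℂ} (hl : l ∈ periodGroup (lift g)) {w : E3}
    (hw : ∀ z ∈ regularSet g, X ((z + l : ℂ) : Cyl) = X (z : Cyl) + w) :
    IsOrientedTranslation g X w (periodHomeo hl) := by
  rintro ⟨x, hx⟩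
  obtain ⟨z, rfl⟩ := QuotientAddGroup.mk_surjective x
  rw [coe_periodHomeo]
  refine ⟨hw z (mem_puncturedCyl_iff.1 hx), ?_⟩
  change gaussMap g (((z + l : ℂ)) : Cyl) = gaussMap g (z : Cyl)
  rw [gaussMap_coe, gaussMap_coe, meromorphicOrderAt_add_period hl, hl z]

theorem isClosed_mk_image {L : AddSubgroup ℂ} [DiscreteTopology L]
    (hL : AddSubgroup.zmultiples Complex.I ≤ L) :
    IsClosed ((QuotientAddGroup.mk : ℂ → Cyl) '' (L : Set ℂ)) := by
  rw [← (QuotientAddGroup.isQuotientMap_mk _).isClosed_preimage]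
  convert AddSubgroup.isClosed_of_discrete (H := L)
  ext z
  refine ⟨?_, fun hz => ⟨z, hz, rfl⟩⟩
  rintro ⟨l, hl, hlz⟩
  have := hL (coe_eq_coe_iff.1 hlz)
  simpa using L.add_mem hl this

/-- Preserving the normal means preserving `g`, so each point moves by a period or is reflected
about the zero `p` modulo periods. The change of height is the constant third coordinate of `w`,
which allows reflection only for countably many values of Re z. -/
theorem IsOrientedTranslation.exists_period (h : DoubleElliptic β c e (lift g))
    (hX : HasWeierstrassPair g X) {w : E3} {φ : puncturedCyl g ≃ₜ puncturedCyl g}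
    (hφ : IsOrientedTranslation g X w φ) :
    ∃ l ∈ periodGroup (lift g), ∀ x, (φ x : Cyl) = x + (l : Cyl) := by
  obtain ⟨p, hp⟩ := h.exists_zero
  have := h.discreteTopology
  set L := periodGroup (lift g) with hLdef
  have hcase : ∀ z (hz : z ∈ regularSet g),
      (φ ⟨z, mem_puncturedCyl_iff.2 hz⟩ : Cyl) - (z : Cyl) ∈
        (QuotientAddGroup.mk : ℂ → Cyl) '' (L : Set ℂ) ∨
      ∃ l ∈ L, z.re = (2 * p.re + l.re - w 2) / 2 := by
    intro z hz
    obtain ⟨z', hz'⟩ := QuotientAddGroup.mk_surjective (φ ⟨z, mem_puncturedCyl_iff.2 hz⟩ : Cyl)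
    have hzr : z' ∈ regularSet g := by
      rw [← mem_puncturedCyl_iff, hz']
      exact (φ _).2
    obtain ⟨h1, h2⟩ := hφ ⟨z, mem_puncturedCyl_iff.2 hz⟩
    rw [← hz'] at h1 h2
    rw [gaussMap_coe_of_order_eq_zero hzr] at h2
    change _ = gaussMap g (z : Cyl) at h2
    rw [gaussMap_coe_of_order_eq_zero hz] at h2
    rcases h.mem_of_apply_eq hp (le_of_eq (Eq.symm hz)) (le_of_eq (Eq.symm hzr))
      (invStereo_injective h2).symm with h3 | h3
    · left
      rw [← hz']
      exact ⟨z' - z, h3, rfl⟩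
    · right
      refine ⟨_, h3, ?_⟩
      have h4 := height_sub h hX hzr hz
      rw [h1] at h4
      simp at h4 ⊢
      linarith
  let ψ : regularSet g → Cyl := fun z => (φ ⟨(z : ℂ), mem_puncturedCyl_iff.2 z.2⟩ : Cyl) - (z : ℂ)
  have hψ : Continuous ψ := by
    have : Continuous fun z : regularSet g =>
        (⟨((z : ℂ) : Cyl), mem_puncturedCyl_iff.2 z.2⟩ : puncturedCyl g) :=
      Continuous.subtype_mk (continuous_quot_mk.comp continuous_subtype_val) _
    exact (continuous_subtype_val.comp (φ.continuous.comp this)).sub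
      (continuous_quot_mk.comp continuous_subtype_val)
  set T : Set ℝ := (fun l : ℂ => (2 * p.re + l.re - w 2) / 2) '' (L : Set ℂ) with hT
  have hTc : T.Countable := h.countable_periodGroup.image _
  have hdense : Dense {z : ℂ | z.re ∉ T} := (hTc.dense_compl ℝ).preimage Complex.isOpenMap_re
  have hdense' : Dense {z : regularSet g | (z : ℂ).re ∉ T} :=
    hdense.preimage h.isOpen_regular.isOpenMap_subtype_val
  -- The exceptional vertical lines have dense complement, and the image of L in the cylinder is
  -- closed.
  have hψL : ∀ z, ψ z ∈ (QuotientAddGroup.mk : ℂ → Cyl) '' (L : Set ℂ) := by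
    have hcl := (isClosed_mk_image (zmultiples_le_periodGroup g)).preimage hψ
    intro z
    refine hcl.closure_subset_iff.2 ?_ (hdense' z)
    intro z hz
    refine (hcase z z.2).resolve_right ?_
    rintro ⟨l, hl, hzl⟩
    exact hz ⟨l, hl, hzl.symm⟩
  -- The displacement is a continuous map from a connected set to a countable, hence totally
  -- disconnected, set.
  have hsub : (range ψ).Subsingleton := by
    have hc : ((QuotientAddGroup.mk : ℂ → Cyl) '' (L : Set ℂ)).Countable :=
      h.countable_periodGroup.image _
    refine hc.isTotallyDisconnected _ (range_subset_iff.2 hψL) ?_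
    have : PreconnectedSpace (regularSet g) :=
      isPreconnected_iff_preconnectedSpace.1 h.isConnected_regular.isPreconnected
    exact isPreconnected_range hψ
  obtain ⟨z₀, hz₀⟩ := h.isConnected_regular.nonempty
  obtain ⟨l, hl, hl'⟩ := hψL ⟨z₀, hz₀⟩
  refine ⟨l, hl, ?_⟩
  rintro ⟨x, hx⟩
  obtain ⟨z, rfl⟩ := QuotientAddGroup.mk_surjective x
  have := hsub ⟨⟨z, mem_puncturedCyl_iff.1 hx⟩, rfl⟩ ⟨⟨z₀, hz₀⟩, rfl⟩
  rw [← hl'] at this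
  exact (sub_eq_iff_eq_add'.1 this)

theorem translationSetoid_iff (h : DoubleElliptic β c e (lift g)) (hX : HasWeierstrassPair g X)
    {x y : puncturedCyl g} : (translationSetoid g X) x y ↔
      ∃ l ∈ periodGroup (lift g), (y : Cyl) = x + (l : Cyl) := by
  constructor
  · rintro ⟨w, φ, hφ, rfl⟩
    obtain ⟨l, hl, hφl⟩ := hφ.exists_period h hX
    exact ⟨l, hl, hφl x⟩
  · rintro ⟨l, hl, hy⟩
    obtain ⟨w, hw⟩ := exists_translation h hX
    exact ⟨w l, periodHomeo hl, isOrientedTranslation_periodHomeo hl (hw l hl).1,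
      Subtype.ext hy.symm⟩

/-- The translation vectors of the oriented translational symmetries form an infinite cyclic group,
generated by a vector that is not horizontal. -/
theorem exists_generator (h : DoubleElliptic β c e (lift g)) (hX : HasWeierstrassPair g X)
    (hre : ∃ l ∈ periodGroup (lift g), l.re ≠ 0) :
    ∃ v : E3, v 2 ≠ 0 ∧ (∀ w : E3, (∃ φ, IsOrientedTranslation g X w φ) ↔
      w ∈ AddSubgroup.zmultiples v) := by
  have := h.discreteTopology
  obtain ⟨w, hw⟩ := exists_translation h hX
  obtain ⟨z₀, hz₀⟩ := h.isConnected_regular.nonempty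
  have hw0 : ∀ l (hl : l ∈ periodGroup (lift g)), w l = X ((z₀ + l : ℂ) : Cyl) - X (z₀ : Cyl) := by
    intro l hl
    rw [(hw l hl).1 z₀ hz₀, add_sub_cancel_left]
  let W : periodGroup (lift g) →+ E3 :=
    { toFun := fun l => w l
      map_zero' := by rw [hw0 _ (0 : periodGroup (lift g)).2]; simp
      map_add' := by
        intro a b
        have hab := (hw b b.2).1 (z₀ + a) ((add_mem_regularSet a.2).2 hz₀)
        rw [hw0 _ (a + b).2, AddSubgroup.coe_add, ← add_assoc, hab, hw0 a a.2]
        abel }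
  have hWI : ∀ (a : periodGroup (lift g)), (a : ℂ) ∈ AddSubgroup.zmultiples Complex.I →
      W a = 0 := by
    intro a ha
    change w a = 0
    rw [hw0 a a.2, sub_eq_zero]
    congr 1
    rw [coe_eq_coe_iff]
    simpa using ha
  -- A period with real part zero has a nonzero multiple in ℤ i, on which `W` vanishes, and ℝ³ has
  -- no torsion. So `W` depends on real parts only, and a period whose real part generates them
  -- yields the generator.
  have hWre : ∀ a : periodGroup (lift g), (a : ℂ).re = 0 → W a = 0 := by
    intro a ha
    obtain ⟨n, m, hn, hm⟩ := AddSubgroup.exists_torsion (I_mem_periodGroup g) a.2 ha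
    have h1 : W ((n : ℤ) • a) = 0 := by
      apply hWI
      rw [AddSubgroup.coe_zsmul, hm]
      exact AddSubgroup.zsmul_mem_zmultiples _ _
    rw [map_zsmul] at h1
    rw [← Int.cast_smul_eq_zsmul ℝ] at h1
    exact (smul_eq_zero.1 h1).resolve_left (by exact_mod_cast hn)
  obtain ⟨l₁, hl₁, hre₁, hgen⟩ := AddSubgroup.exists_re_generator (I_mem_periodGroup g) hre
  refine ⟨w l₁, by rwa [(hw l₁ hl₁).2], fun u => ⟨?_, ?_⟩⟩
  · rintro ⟨φ, hφ⟩
    obtain ⟨l, hl, hφl⟩ := hφ.exists_period h hX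
    have hu : u = w l := by
      have h1 := (hφ ⟨z₀, mem_puncturedCyl_iff.2 hz₀⟩).1
      rw [hφl] at h1
      have h2 := (hw l hl).1 z₀ hz₀
      rw [QuotientAddGroup.mk_add] at h2
      exact add_left_cancel (h1.symm.trans h2)
    obtain ⟨k, hk⟩ := hgen l hl
    refine AddSubgroup.mem_zmultiples_iff.2 ⟨k, ?_⟩
    have h3 : W (⟨l, hl⟩ - k • ⟨l₁, hl₁⟩) = 0 := by
      apply hWre
      simp [hk]
    rw [map_sub, map_zsmul, sub_eq_zero] at h3
    rw [hu]
    exact h3.symm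
  · intro hu
    obtain ⟨k, rfl⟩ := AddSubgroup.mem_zmultiples_iff.1 hu
    have hk : k • l₁ ∈ periodGroup (lift g) := AddSubgroup.zsmul_mem _ hl₁ k
    refine ⟨periodHomeo hk, ?_⟩
    have h3 : w (k • l₁) = k • w l₁ := map_zsmul W k ⟨l₁, hl₁⟩
    rw [← h3]
    exact isOrientedTranslation_periodHomeo hk (hw _ hk).1

theorem image_translate {w : E3} {φ : puncturedCyl g ≃ₜ puncturedCyl g}
    (hφ : IsOrientedTranslation g X w φ) :
    (fun y => y + w) '' (X '' puncturedCyl g) = X '' puncturedCyl g := by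
  ext y
  constructor
  · rintro ⟨_, ⟨x, hx, rfl⟩, rfl⟩
    exact ⟨φ ⟨x, hx⟩, (φ ⟨x, hx⟩).2, (hφ ⟨x, hx⟩).1⟩
  · rintro ⟨x, hx, rfl⟩
    refine ⟨X (φ.symm ⟨x, hx⟩), ⟨_, (φ.symm ⟨x, hx⟩).2, rfl⟩, ?_⟩
    have := (hφ (φ.symm ⟨x, hx⟩)).1
    rw [φ.apply_symm_apply] at this
    exact this.symm

end RiemannType

theorem Topology.IsQuotientMap.exists_homeomorph {A B : Type*} [TopologicalSpace A]
    [TopologicalSpace B] {f : A → B} (hf : IsQuotientMap f) (s : Setoid A)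
    (hs : ∀ x y, s x y ↔ f x = f y) : ∃ ψ : Quotient s ≃ₜ B, ∀ x, ψ (Quotient.mk s x) = f x := by
  obtain rfl : s = Setoid.ker f := by
    ext x y
    exact hs x y
  exact ⟨Topology.IsQuotientMap.homeomorph (f := ⟨f, hf.continuous⟩) hf, fun x => rfl⟩

/-! ### The quotient as a twice punctured torus. -/

namespace RiemannType
variable {g : Cyl → ℂ} {X : Cyl → E3} {β c e : ℂ}

/-- The covering of the torus of periods by the cylinder. -/
def toTorus (g : Cyl → ℂ) : Cyl →+ ℂ ⧸ periodGroup (lift g) :=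
  QuotientAddGroup.map _ _ (AddMonoidHom.id ℂ) (zmultiples_le_periodGroup g)

theorem toTorus_coe (z : ℂ) : toTorus g (z : Cyl) = (z : ℂ ⧸ periodGroup (lift g)) := rfl

theorem continuous_toTorus : Continuous (toTorus g) :=
  (QuotientAddGroup.isQuotientMap_mk _).continuous_iff.2 continuous_quot_mk

theorem isOpenMap_toTorus : IsOpenMap (toTorus g) := by
  intro U hU
  have h1 : toTorus g '' U = (QuotientAddGroup.mk : ℂ → ℂ ⧸ periodGroup (lift g)) ''
      ((QuotientAddGroup.mk : ℂ → Cyl) ⁻¹' U) := by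
    ext t
    constructor
    · rintro ⟨x, hx, rfl⟩
      obtain ⟨z, rfl⟩ := QuotientAddGroup.mk_surjective x
      exact ⟨z, hx, rfl⟩
    · rintro ⟨z, hz, rfl⟩
      exact ⟨z, hz, rfl⟩
  rw [h1]
  exact QuotientAddGroup.isOpenMap_coe _ (hU.preimage continuous_quot_mk)

theorem torus_coe_eq_iff {z w : ℂ} : (z : ℂ ⧸ periodGroup (lift g)) = w ↔
    w - z ∈ periodGroup (lift g) := by
  rw [QuotientAddGroup.eq, neg_add_eq_sub]

theorem mem_regularSet_iff_torus (h : DoubleElliptic β c e (lift g)) {p q : ℂ}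
    (hp : meromorphicOrderAt (lift g) p = 2) (hq : meromorphicOrderAt (lift g) q = -2) {z : ℂ} :
    z ∈ regularSet g ↔ (z : ℂ ⧸ periodGroup (lift g)) ≠ p ∧
      (z : ℂ ⧸ periodGroup (lift g)) ≠ q := by
  rw [Ne, Ne, eq_comm, torus_coe_eq_iff, eq_comm, torus_coe_eq_iff]
  exact h.regular_eq hp hq

/-- The projection of the punctured cylinder to the punctured torus is open, hence a quotient map,
and its fibres are the orbits of the period translations, which are the classes of the setoid. -/
theorem exists_quotient_homeomorph (h : DoubleElliptic β c e (lift g))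
    (hX : HasWeierstrassPair g X) {p q : ℂ} (hp : meromorphicOrderAt (lift g) p = 2)
    (hq : meromorphicOrderAt (lift g) q = -2) :
    ∃ ψ : OrientableQuotient g X ≃ₜ {t : ℂ ⧸ periodGroup (lift g) // t ≠ p ∧ t ≠ q},
      ∀ (z : ℂ) (hz : (z : Cyl) ∈ puncturedCyl g),
        (ψ (Quotient.mk (translationSetoid g X) ⟨(z : Cyl), hz⟩) : ℂ ⧸ periodGroup (lift g)) =
          (z : ℂ ⧸ periodGroup (lift g)) := by
  have hpre : ∀ x : Cyl, x ∈ puncturedCyl g ↔ toTorus g x ≠ p ∧ toTorus g x ≠ q := by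
    intro x
    obtain ⟨z, rfl⟩ := QuotientAddGroup.mk_surjective x
    rw [toTorus_coe]
    exact mem_puncturedCyl_iff.trans (mem_regularSet_iff_torus h hp hq)
  have hS : IsOpen (puncturedCyl g) := by
    rw [← (QuotientAddGroup.isQuotientMap_mk _).isOpen_preimage]
    convert h.isOpen_regular
    ext z
    exact mem_puncturedCyl_iff
  let F : puncturedCyl g → {t : ℂ ⧸ periodGroup (lift g) // t ≠ p ∧ t ≠ q} :=
    fun x => ⟨toTorus g x, (hpre x).1 x.2⟩
  have hF : IsQuotientMap F := by
    refine IsOpenMap.isQuotientMap ?_ ?_ ?_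
    · intro U hU
      refine isOpen_induced_iff.2 ⟨_, isOpenMap_toTorus _ (hS.isOpenMap_subtype_val U hU), ?_⟩
      ext t
      constructor
      · rintro ⟨_, ⟨x, hx, rfl⟩, hxt⟩
        exact ⟨x, hx, Subtype.ext hxt⟩
      · rintro ⟨x, hx, rfl⟩
        exact ⟨x, ⟨x, hx, rfl⟩, rfl⟩
    · exact (continuous_toTorus.comp continuous_subtype_val).subtype_mk _
    · rintro ⟨t, ht⟩
      obtain ⟨z, rfl⟩ := QuotientAddGroup.mk_surjective t
      exact ⟨⟨(z : Cyl), (hpre _).2 ht⟩, rfl⟩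
  obtain ⟨ψ, hψ⟩ := hF.exists_homeomorph (translationSetoid g X) (fun x y => by
    rw [translationSetoid_iff h hX, Subtype.ext_iff]
    obtain ⟨x, hx⟩ := x
    obtain ⟨y, hy⟩ := y
    obtain ⟨z, rfl⟩ := QuotientAddGroup.mk_surjective x
    obtain ⟨w, rfl⟩ := QuotientAddGroup.mk_surjective y
    change _ ↔ (z : ℂ ⧸ periodGroup (lift g)) = w
    rw [torus_coe_eq_iff]
    constructor
    · rintro ⟨l, hl, hwl⟩
      change ((w : ℂ) : Cyl) = ((z + l : ℂ) : Cyl) at hwl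
      have := zmultiples_le_periodGroup g (coe_eq_coe_iff.1 hwl.symm)
      have := add_mem this hl
      rwa [show w - (z + l) + l = w - z by ring] at this
    · intro hwz
      refine ⟨w - z, hwz, ?_⟩
      change ((w : ℂ) : Cyl) = ((z + (w - z) : ℂ) : Cyl)
      rw [add_sub_cancel])
  exact ⟨ψ, fun z hz => by rw [hψ]; rfl⟩

/-! ### Minimality and curvature of the Weierstrass immersion. -/

/-- The partial derivatives of a map with `dY_j = Re (c_j dz)`. -/
theorem dx_dy_of_hasFDerivAt {Y : ℂ → E3} {z : ℂ} {c : Fin 3 → ℂ}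
    (hY : ∀ j, HasFDerivAt (fun ζ => Y ζ j)
      (Complex.reCLM.comp (c j • ContinuousLinearMap.id ℝ ℂ)) z) :
    dx Y z = WithLp.toLp 2 (fun j => (c j).re) ∧ dy Y z = WithLp.toLp 2 (fun j => -(c j).im) := by
  have hd : DifferentiableAt ℝ Y z := by
    rw [differentiableAt_euclidean]
    exact fun j => (hY j).differentiableAt
  have hj : ∀ j u, fderiv ℝ Y z u j = (c j * u).re := by
    intro j u
    have h1 : HasFDerivAt (fun ζ => Y ζ j)
        ((EuclideanSpace.proj j : E3 →L[ℝ] ℝ).comp (fderiv ℝ Y z)) z :=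
      (EuclideanSpace.proj j : E3 →L[ℝ] ℝ).hasFDerivAt.comp z hd.hasFDerivAt
    have := congrArg (fun A : ℂ →L[ℝ] ℝ => A u) (h1.unique (hY j))
    simpa using this
  constructor
  · ext j
    simp [dx, hj]
  · ext j
    simp [dy, hj]

theorem hasFDerivAt_re_comp {F : ℂ → ℂ} {z d : ℂ} (hF : HasDerivAt F d z) :
    HasFDerivAt (fun ζ => (F ζ).re) (Complex.reCLM.comp (d • ContinuousLinearMap.id ℝ ℂ)) z := by
  have := Complex.reCLM.hasFDerivAt.comp z (hF.hasFDerivAt.restrictScalars ℝ)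
  convert! this using 1
  ext u
  simp [mul_comm]

section WeierstrassAlgebra

theorem weierstrassForm_zero (f : ℂ → ℂ) (z : ℂ) :
    weierstrassForm f z 0 = (1 / 2) * (1 / f z - f z) := rfl

theorem weierstrassForm_one (f : ℂ → ℂ) (z : ℂ) :
    weierstrassForm f z 1 = (Complex.I / 2) * (1 / f z + f z) := rfl

theorem weierstrassForm_two (f : ℂ → ℂ) (z : ℂ) : weierstrassForm f z 2 = 1 := rfl

theorem weierstrassForm_sq {f : ℂ → ℂ} {z : ℂ} (hz : f z ≠ 0) :
    weierstrassForm f z 0 ^ 2 + weierstrassForm f z 1 ^ 2 + 1 = 0 := by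
  rw [weierstrassForm_zero, weierstrassForm_one]
  field_simp
  ring_nf
  simp

theorem conformal_of_weierstrassForm {f : ℂ → ℂ} {z : ℂ} (hz : f z ≠ 0) {a b : E3}
    (ha : a = WithLp.toLp 2 (fun j => (weierstrassForm f z j).re))
    (hb : b = WithLp.toLp 2 (fun j => -(weierstrassForm f z j).im)) :
    a ≠ 0 ∧ ‖a‖ = ‖b‖ ∧ inner ℝ a b = 0 := by
  have h := weierstrassForm_sq hz
  have hre := congrArg Complex.re h
  have him := congrArg Complex.im h
  simp [pow_two] at hre him
  refine ⟨fun h0 => ?_, ?_, ?_⟩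
  · have := congrArg (fun v : E3 => v 2) (ha.symm.trans h0)
    simp [weierstrassForm_two] at this
  · rw [EuclideanSpace.norm_eq, EuclideanSpace.norm_eq, ha, hb]
    congr 1
    simp [Fin.sum_univ_three, weierstrassForm_two]
    linarith
  · rw [ha, hb]
    simp [PiLp.inner_apply, Fin.sum_univ_three, weierstrassForm_two]
    linarith

theorem norm_sq_of_weierstrassForm {f : ℂ → ℂ} {z : ℂ} (hz : f z ≠ 0) :
    ‖(WithLp.toLp 2 (fun j => (weierstrassForm f z j).re) : E3)‖ ^ 2 =
      (1 + Complex.normSq (f z)) ^ 2 / (4 * Complex.normSq (f z)) := by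
  have hm : Complex.normSq (f z) ≠ 0 := (Complex.normSq_pos.2 hz).ne'
  rw [EuclideanSpace.norm_sq_eq, Fin.sum_univ_three]
  simp only [weierstrassForm_two, weierstrassForm_zero, weierstrassForm_one, Real.norm_eq_abs,
    sq_abs]
  generalize f z = w at *
  simp
  field_simp
  rw [Complex.normSq_apply]
  ring

theorem cross_of_weierstrassForm {f : ℂ → ℂ} {z : ℂ} (hz : f z ≠ 0) :
    cross (WithLp.toLp 2 (fun j => (weierstrassForm f z j).re))
      (WithLp.toLp 2 (fun j => -(weierstrassForm f z j).im)) =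
      ((1 + Complex.normSq (f z)) ^ 2 / (4 * Complex.normSq (f z))) • invStereo (f z) := by
  have hm : Complex.normSq (f z) ≠ 0 := (Complex.normSq_pos.2 hz).ne'
  have hm' : Complex.normSq (f z) + 1 ≠ 0 := by positivity [Complex.normSq_nonneg (f z)]
  ext j
  simp only [cross, invStereo, weierstrassForm_two, weierstrassForm_zero, weierstrassForm_one,
    Complex.sq_norm]
  generalize f z = w at *
  fin_cases j
  all_goals
    simp
    field_simp
    simp only [Complex.normSq_apply]
    ring

theorem norm_invStereo (w : ℂ) : ‖invStereo w‖ = 1 := by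
  have hm' : Complex.normSq w + 1 ≠ 0 := by positivity [Complex.normSq_nonneg w]
  rw [← sq_eq_sq₀ (norm_nonneg _) zero_le_one, EuclideanSpace.norm_sq_eq, Fin.sum_univ_three]
  simp only [invStereo, Complex.sq_norm, Real.norm_eq_abs, sq_abs]
  simp
  field_simp
  simp only [Complex.normSq_apply]
  ring

/-- With w = g and d = g', this pairs the derivative of the Weierstrass form with the normal. The
real and imaginary parts of -g'/g supply the entries of the second fundamental form. -/
theorem hopf_of_weierstrassForm {w d : ℂ} (hw : w ≠ 0) :
    ((1 / 2) * (-d / w ^ 2 - d)) * (invStereo w 0 : ℂ)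
      + ((Complex.I / 2) * (-d / w ^ 2 + d)) * (invStereo w 1 : ℂ) = -d / w := by
  have hm' : Complex.normSq w + 1 ≠ 0 := by positivity [Complex.normSq_nonneg w]
  have hm : ((Complex.normSq w : ℂ)) + 1 ≠ 0 := by exact_mod_cast hm'
  have hmc := Complex.mul_conj w
  have e0 : (invStereo w 0 : ℂ) = (w + (starRingEnd ℂ) w) / (Complex.normSq w + 1) := by
    rw [Complex.add_conj]
    simp [invStereo, Complex.sq_norm]
    field_simp
  have e1 : (invStereo w 1 : ℂ) =
      -Complex.I * (w - (starRingEnd ℂ) w) / (Complex.normSq w + 1) := by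
    rw [Complex.sub_conj]
    simp [invStereo, Complex.sq_norm]
    field_simp
    simp
  rw [e0, e1, ← hmc]
  rw [← hmc] at hm
  field_simp
  ring_nf
  simp
  ring

end WeierstrassAlgebra

theorem eventually_mem_regularSet (h : DoubleElliptic β c e (lift g)) {z : ℂ}
    (hz : z ∈ regularSet g) : ∀ᶠ ζ in 𝓝 z, ζ ∈ regularSet g := h.isOpen_regular.mem_nhds hz

theorem analyticAt_of_mem_regularSet (h : DoubleElliptic β c e (lift g)) {z : ℂ}
    (hz : z ∈ regularSet g) : AnalyticAt ℂ (lift g) z := h.analyticAt (le_of_eq (Eq.symm hz))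

theorem lift_ne_zero (h : DoubleElliptic β c e (lift g)) {z : ℂ}
    (hz : z ∈ regularSet g) : lift g z ≠ 0 := h.ne_zero_iff.2 hz

theorem dx_dy_lift (hX : HasWeierstrassPair g X) {z : ℂ} (hz : z ∈ regularSet g) :
    dx (lift X) z = WithLp.toLp 2 (fun j => (weierstrassForm (lift g) z j).re) ∧
    dy (lift X) z = WithLp.toLp 2 (fun j => -(weierstrassForm (lift g) z j).im) :=
  dx_dy_of_hasFDerivAt (hX z (mem_puncturedCyl_iff.2 hz))

theorem hasDerivAt_weierstrassForm {f : ℂ → ℂ} {z : ℂ} (hf : AnalyticAt ℂ f z) (hz : f z ≠ 0)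
    (j : Fin 3) : HasDerivAt (fun ζ => weierstrassForm f ζ j)
      (![(1 / 2) * (-deriv f z / f z ^ 2 - deriv f z),
        (Complex.I / 2) * (-deriv f z / f z ^ 2 + deriv f z), 0] j) z := by
  have h1 := hf.differentiableAt.hasDerivAt
  have h2 : HasDerivAt (fun ζ => 1 / f ζ) (-deriv f z / f z ^ 2) z := by
    simpa only [one_div] using! h1.inv hz
  fin_cases j
  · exact (h2.sub h1).const_mul _
  · exact (h2.add h1).const_mul _
  · exact hasDerivAt_const _ _

/-- Conformality is the vanishing of the sum of squares of the form; harmonicity holds because each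
coordinate is locally the real part of a holomorphic primitive. -/
theorem isMinimalImmersionAt (h : DoubleElliptic β c e (lift g)) (hX : HasWeierstrassPair g X)
    {z : ℂ} (hz : z ∈ regularSet g) : IsMinimalImmersionAt (lift X) z := by
  refine ⟨?_, fun j => ?_⟩
  · filter_upwards [eventually_mem_regularSet h hz] with ζ hζ
    exact conformal_of_weierstrassForm (lift_ne_zero h hζ) (dx_dy_lift hX hζ).1 (dx_dy_lift hX hζ).2
  · obtain ⟨r, hr, hball⟩ := Metric.mem_nhds_iff.1 (eventually_mem_regularSet h hz)
    have hd : DifferentiableOn ℂ (fun ζ => weierstrassForm (lift g) ζ j) (Metric.ball z r) :=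
      fun ζ hζ => (hasDerivAt_weierstrassForm (analyticAt_of_mem_regularSet h (hball hζ))
        (lift_ne_zero h (hball hζ)) j).differentiableAt.differentiableWithinAt
    obtain ⟨F, hF⟩ := hd.isExactOn_ball
    have hFa : AnalyticAt ℂ F z := by
      have : DifferentiableOn ℂ F (Metric.ball z r) := fun ζ hζ =>
        (hF ζ hζ).differentiableAt.differentiableWithinAt
      exact this.analyticAt (Metric.ball_mem_nhds z hr)
    have hconst : ∀ ζ ∈ Metric.ball z r,
        lift X ζ j - (F ζ).re = lift X z j - (F z).re := by
      intro ζ hζ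
      have hder : ∀ ζ ∈ Metric.ball z r,
          HasFDerivAt (fun ζ => lift X ζ j - (F ζ).re) (0 : ℂ →L[ℝ] ℝ) ζ := by
        intro ζ hζ
        have := (hX ζ (mem_puncturedCyl_iff.2 (hball hζ)) j).sub (hasFDerivAt_re_comp (hF ζ hζ))
        rwa [sub_self] at this
      exact Metric.isOpen_ball.is_const_of_fderiv_eq_zero (𝕜 := ℝ)
        (convex_ball z r).isPreconnected
        (fun ζ hζ => (hder ζ hζ).differentiableAt.differentiableWithinAt)
        (fun ζ hζ => (hder ζ hζ).fderiv) hζ (Metric.mem_ball_self hr)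
    have hFa' : AnalyticAt ℂ (fun ζ => F ζ + ((lift X z j - (F z).re : ℝ) : ℂ)) z :=
      hFa.add analyticAt_const
    refine (InnerProductSpace.harmonicAt_congr_nhds ?_).2 hFa'.harmonicAt_re
    filter_upwards [Metric.ball_mem_nhds z hr] with ζ hζ
    rw [Complex.add_re, Complex.ofReal_re, ← hconst ζ hζ]
    ring

/-- The curvature form of the minimal surface with Weierstrass pair `(g, dz)` is the pull back of
the spherical area form, up to the sign. -/
theorem gaussCurvature_mul_areaDensity (h : DoubleElliptic β c e (lift g))
    (hX : HasWeierstrassPair g X) {z : ℂ} (hz : z ∈ regularSet g) :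
    gaussCurvature (lift X) z * areaDensity (lift X) z =
      -(Complex.normSq (deriv (lift g) z) * (4 / (1 + Complex.normSq (lift g z)) ^ 2)) := by
  have hne := lift_ne_zero h hz
  have hm : 0 < Complex.normSq (lift g z) := Complex.normSq_pos.2 hne
  obtain ⟨hx, hy⟩ := dx_dy_lift hX hz
  obtain ⟨-, hxy, hin⟩ := conformal_of_weierstrassForm hne hx hy
  set E : ℝ := (1 + Complex.normSq (lift g z)) ^ 2 / (4 * Complex.normSq (lift g z)) with hE
  have hE0 : 0 < E := by positivity
  have hEx : ‖dx (lift X) z‖ ^ 2 = E := by rw [hx, norm_sq_of_weierstrassForm hne]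
  have hfirst : firstFormDet (lift X) z = E ^ 2 := by
    rw [firstFormDet, hin, ← hxy, hEx]
    ring
  have hnormal : unitNormal (lift X) z = invStereo (lift g z) := by
    rw [unitNormal, hx, hy, cross_of_weierstrassForm hne, ← hE, norm_smul, norm_invStereo,
      Real.norm_of_nonneg hE0.le, smul_smul, mul_one, one_div_mul_cancel hE0.ne', one_smul]
  have hD := hasDerivAt_weierstrassForm (analyticAt_of_mem_regularSet h hz) hne
  set D : Fin 3 → ℂ := ![(1 / 2) * (-deriv (lift g) z / lift g z ^ 2 - deriv (lift g) z),
        (Complex.I / 2) * (-deriv (lift g) z / lift g z ^ 2 + deriv (lift g) z), 0] with hDdef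
  have hxx := dx_dy_of_hasFDerivAt (Y := dx (lift X)) (z := z) (c := D) (fun j => by
    refine (hasFDerivAt_re_comp (hD j)).congr_of_eventuallyEq ?_
    filter_upwards [eventually_mem_regularSet h hz] with ζ hζ
    rw [(dx_dy_lift hX hζ).1])
  -- The y-derivative is -Im Φ = Re (iΦ), so it too has the form to which the differentiation lemma
  -- applies.
  have hyy := dx_dy_of_hasFDerivAt (Y := dy (lift X)) (z := z) (c := fun j => Complex.I * D j)
    (fun j => by
      refine (hasFDerivAt_re_comp ((hD j).const_mul Complex.I)).congr_of_eventuallyEq ?_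
      filter_upwards [eventually_mem_regularSet h hz] with ζ hζ
      rw [(dx_dy_lift hX hζ).2]
      simp)
  set H : ℂ := -deriv (lift g) z / lift g z with hH
  have hopf : D 0 * (invStereo (lift g z) 0 : ℂ) + D 1 * (invStereo (lift g z) 1 : ℂ) = H :=
    hopf_of_weierstrassForm hne
  have hD2 : D 2 = 0 := rfl
  have hre := congrArg Complex.re hopf
  have him := congrArg Complex.im hopf
  simp only [Complex.add_re, Complex.add_im, Complex.re_mul_ofReal,
    Complex.im_mul_ofReal] at hre him
  have hsecond : secondFormDet (lift X) z = -Complex.normSq H := by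
    rw [secondFormDet, hxx.1, hyy.1, hyy.2, hnormal]
    simp only [PiLp.inner_apply, Fin.sum_univ_three, hD2]
    simp
    rw [Complex.normSq_apply, ← hre, ← him]
    ring
  have hHn : Complex.normSq H = Complex.normSq (deriv (lift g) z) / Complex.normSq (lift g z) := by
    rw [hH, map_div₀, Complex.normSq_neg]
  rw [gaussCurvature, areaDensity, hfirst, hsecond, Real.sqrt_sq hE0.le, hHn, hE]
  field_simp

end RiemannType

/-! ### Planar ends. -/

theorem isPreconnected_ball_diff_center (p : ℂ) {r : ℝ} (hr : 0 < r) :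
    IsPreconnected (Metric.ball p r \ {p}) := by
  have h1 : (OpenPartialHomeomorph.univBall p r) '' {0}ᶜ = Metric.ball p r \ {p} := by
    have hinj : InjOn (OpenPartialHomeomorph.univBall p r) univ := by
      simpa using (OpenPartialHomeomorph.univBall p r).injOn
    rw [compl_eq_univ_sdiff, image_sdiff_of_injOn hinj (subset_univ _)]
    have h2 := (OpenPartialHomeomorph.univBall p r).image_source_eq_target
    rw [OpenPartialHomeomorph.univBall_source, OpenPartialHomeomorph.univBall_target p hr] at h2
    rw [h2, image_singleton, OpenPartialHomeomorph.univBall_apply_zero]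
  rw [← h1]
  refine IsPreconnected.image ?_ _ (OpenPartialHomeomorph.continuous_univBall p r).continuousOn
  refine (isConnected_compl_singleton_of_one_lt_rank ?_ 0).isPreconnected
  rw [Complex.rank_real_complex]
  exact Nat.one_lt_ofNat

namespace RiemannType
variable {g : Cyl → ℂ} {X : Cyl → E3} {β c e : ℂ}

/-- A puncture at which the horizontal projection has a simple pole, up to a `C¹` function, and the
height is the real part of the coordinate, is a planar end. -/
theorem isPlanarEnd_of_expansion {Y : ℂ → E3} {p A : ℂ} (hA : A ≠ 0) {φ : ℂ → ℂ}
    (hφ : ContDiffAt ℝ 1 φ p) (T : E3 ≃ₗᵢ[ℝ] E3) {b : ℝ}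
    (hcont : ∀ᶠ z in 𝓝[≠] p, ContinuousAt Y z)
    (hT : ∀ᶠ z in 𝓝[≠] p, (T (Y z) 0 : ℂ) + T (Y z) 1 * Complex.I = A / (z - p) + φ z)
    (hh : ∀ᶠ z in 𝓝[≠] p, T (Y z) 2 = z.re + b) : IsPlanarEnd Y p := by
  set k : ℂ → ℂ := fun z => A + (z - p) * φ z with hk
  -- This is the reciprocal of the horizontal projection, extended by 0 at `p`. Its differential
  -- there is multiplication by A⁻¹, so the C¹ inverse function theorem makes it a chart around `p`.
  set W : ℂ → ℂ := fun z => (z - p) * (k z)⁻¹ with hW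
  have hkp : k p = A := by simp [hk]
  have hkc : ContDiffAt ℝ 1 k p :=
    contDiffAt_const.add ((contDiffAt_id.sub contDiffAt_const).mul hφ)
  have hWc : ContDiffAt ℝ 1 W p :=
    (contDiffAt_id.sub contDiffAt_const).mul (hkc.inv (by rwa [hkp]))
  let L : ℂ ≃L[ℝ] ℂ :=
    (ContinuousLinearEquiv.unitsEquivAut ℂ (Units.mk0 A⁻¹ (inv_ne_zero hA))).restrictScalars ℝ
  have hW' : HasFDerivAt W (L : ℂ →L[ℝ] ℂ) p := by
    have h1 : DifferentiableAt ℝ (fun z => (k z)⁻¹) p :=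
      (hkc.inv (by rwa [hkp])).differentiableAt one_ne_zero
    have h2 := ((hasFDerivAt_id (𝕜 := ℝ) p).sub_const p).mul h1.hasFDerivAt
    convert! h2 using 1
    ext u
    simp [L, hkp, mul_comm]
  have hWp : W p = 0 := by simp [hW]
  set ε := hWc.toOpenPartialHomeomorph W hW' one_ne_zero with hε
  have hεW : ∀ z, ε z = W z := fun z => rfl
  have hpε : p ∈ ε.source := hWc.mem_toOpenPartialHomeomorph_source hW' one_ne_zero
  have hev : ∀ᶠ z in 𝓝 p, k z ≠ 0 ∧ ‖k z‖ < ‖A‖ + 1 ∧ ‖φ z‖ < ‖φ p‖ + 1 ∧ (z ≠ p →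
      ContinuousAt Y z ∧ ((T (Y z) 0 : ℂ) + T (Y z) 1 * Complex.I = A / (z - p) + φ z) ∧
      T (Y z) 2 = z.re + b) := by
    have h1 := hkc.continuousAt.eventually_ne (by rwa [hkp] : k p ≠ 0)
    have h2 := hkc.continuousAt.norm.eventually_lt_const (by rw [hkp]; linarith : ‖k p‖ < ‖A‖ + 1)
    have h3 := hφ.continuousAt.norm.eventually_lt_const (by linarith : ‖φ p‖ < ‖φ p‖ + 1)
    have h4 := eventually_nhdsWithin_iff.1 (hcont.and (hT.and hh))
    filter_upwards [h1, h2, h3, h4] with z h1 h2 h3 h4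
    exact ⟨h1, h2, h3, h4⟩
  obtain ⟨N, hN, hNo, hpN⟩ := eventually_nhds_iff.1 hev
  set δ := ε.restrOpen N hNo with hδ
  have hδs : δ.source = ε.source ∩ N := ε.restrOpen_source N hNo
  have hδW : ∀ z, δ z = W z := fun z => rfl
  have hpδ : p ∈ δ.source := by rw [hδs]; exact ⟨hpε, hpN⟩
  have ht : δ.target ∈ 𝓝 (0 : ℂ) := by
    refine δ.open_target.mem_nhds ?_
    rw [← hWp, ← hδW]
    exact δ.map_source hpδ
  obtain ⟨ρ, hρ, hball⟩ := Metric.mem_nhds_iff.1 ht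
  set U := δ.source ∩ δ ⁻¹' Metric.ball 0 ρ with hU
  have hUo : IsOpen U := δ.isOpen_inter_preimage Metric.isOpen_ball
  have hpU : p ∈ U := ⟨hpδ, by simp [hδW, hWp, hρ]⟩
  have hUN : ∀ z ∈ U, z ∈ N := fun z hz => by
    have := hz.1
    rw [hδs] at this
    exact this.2
  have hinj : InjOn W U := fun z hz w hw hzw => δ.injOn hz.1 hw.1 hzw
  have hW0 : ∀ z ∈ U \ {p}, W z ≠ 0 := by
    intro z hz h0
    exact hz.2 (hinj hz.1 hpU (by rw [h0, hWp]))
  have hZ : ∀ z ∈ U \ {p}, (T (Y z) 0 : ℂ) + T (Y z) 1 * Complex.I = (W z)⁻¹ := by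
    intro z hz
    have h1 := (hN z (hUN z hz.1)).2.2.2 hz.2
    have hzp : z - p ≠ 0 := sub_ne_zero.2 hz.2
    rw [h1.2.1]
    simp only [hW, mul_inv, inv_inv, hk]
    field_simp
  have hre : ∀ z ∈ U \ {p}, T (Y z) 0 = ((W z)⁻¹).re := fun z hz => by rw [← hZ z hz]; simp
  have him : ∀ z ∈ U \ {p}, T (Y z) 1 = ((W z)⁻¹).im := fun z hz => by rw [← hZ z hz]; simp
  have hr2 : ∀ z ∈ U \ {p}, T (Y z) 0 ^ 2 + T (Y z) 1 ^ 2 = (‖W z‖ ^ 2)⁻¹ := by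
    intro z hz
    rw [hre z hz, him z hz, ← inv_pow, ← norm_inv, ← Complex.normSq_eq_norm_sq,
      Complex.normSq_apply]
    ring
  have hWlt : ∀ z ∈ U, ‖W z‖ < ρ := fun z hz => mem_ball_zero_iff.1 hz.2
  refine ⟨T, U, ρ⁻¹, b + p.re, A.re, A.im, (‖A‖ + 1) * (‖φ p‖ + 1), hUo, hpU, inv_pos.2 hρ,
    ?_, ⟨?_, ?_, ?_⟩, ?_, ?_⟩
  · intro z hz
    exact ((hN z (hUN z hz.1)).2.2.2 hz.2).1.continuousWithinAt
  · intro z hz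
    change ρ⁻¹ ^ 2 < T (Y z) 0 ^ 2 + T (Y z) 1 ^ 2
    rw [hr2 z hz, inv_pow]
    have h0 : 0 < ‖W z‖ := norm_pos_iff.2 (hW0 z hz)
    have h1 := hWlt z hz.1
    gcongr
  · intro z hz w hw hzw
    simp only [Prod.mk.injEq] at hzw
    refine hinj hz.1 hw.1 (inv_injective ?_)
    rw [← hZ z hz, ← hZ w hw, hzw.1, hzw.2]
  · rintro ⟨s, t⟩ hst
    have hst' : ρ⁻¹ ^ 2 < s ^ 2 + t ^ 2 := hst
    set ω : ℂ := s + t * Complex.I with hω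
    have hωn : ‖ω‖ ^ 2 = s ^ 2 + t ^ 2 := by
      rw [← Complex.normSq_eq_norm_sq, Complex.normSq_add_mul_I]
    rw [← hωn] at hst'
    have hω1 : ρ⁻¹ < ‖ω‖ := lt_of_pow_lt_pow_left₀ 2 (norm_nonneg _) hst'
    have hω0 : 0 < ‖ω‖ := (inv_pos.2 hρ).trans hω1
    have hmem : ω⁻¹ ∈ Metric.ball (0 : ℂ) ρ := by
      rw [mem_ball_zero_iff, norm_inv]
      exact inv_lt_of_inv_lt₀ hρ hω1
    have hz1 : δ (δ.symm ω⁻¹) = ω⁻¹ := δ.right_inv (hball hmem)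
    have hzU : δ.symm ω⁻¹ ∈ U := ⟨δ.map_target (hball hmem), by rw [mem_preimage, hz1]; exact hmem⟩
    rw [hδW] at hz1
    have hzp : δ.symm ω⁻¹ ∈ U \ {p} := by
      refine ⟨hzU, fun h0 => ?_⟩
      rw [mem_singleton_iff] at h0
      rw [h0, hWp] at hz1
      exact (inv_ne_zero (norm_pos_iff.1 hω0)) hz1.symm
    refine ⟨_, hzp, ?_⟩
    simp only [hre _ hzp, him _ hzp, hz1, inv_inv]
    simp [hω]
  · intro z hz
    obtain ⟨h1, h2, h3, h4⟩ := hN z (hUN z hz.1)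
    obtain ⟨-, -, h5⟩ := h4 hz.2
    have hw0 := hW0 z hz
    have hwn : 0 < ‖W z‖ := norm_pos_iff.2 hw0
    -- Inverting `W` to second order: the linear term has real part (c₁ x₁ + c₂ x₂)/r² since x₁ + i
    -- x₂ = 1/W, with c₁ + i c₂ = A, and the remainder is O(|W|²) = O(r⁻²).
    have hzW : z - p = A * W z + W z ^ 2 * (k z * φ z) := by
      have e1 : z - p = W z * k z := by
        simp only [hW]
        field_simp
      have e2 : k z = A + W z * k z * φ z := by
        rw [← e1]
      calc z - p = W z * k z := e1
        _ = W z * (A + W z * k z * φ z) := by rw [← e2]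
        _ = _ := by ring
    have hlin : (A.re * T (Y z) 0 + A.im * T (Y z) 1) / (T (Y z) 0 ^ 2 + T (Y z) 1 ^ 2) =
        (A * W z).re := by
      rw [hr2 z hz, hre z hz, him z hz, Complex.inv_re, Complex.inv_im, Complex.normSq_eq_norm_sq,
        Complex.mul_re A (W z)]
      have := hwn.ne'
      generalize W z = u at this ⊢
      field_simp
      ring
    rw [hlin, hr2 z hz, h5, div_inv_eq_mul]
    have e3 : z.re + b - (b + p.re + (A * W z).re) = (W z ^ 2 * (k z * φ z)).re := by
      have := congrArg Complex.re hzW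
      rw [Complex.sub_re, Complex.add_re] at this
      linarith
    rw [e3]
    calc |(W z ^ 2 * (k z * φ z)).re| ≤ ‖W z ^ 2 * (k z * φ z)‖ := Complex.abs_re_le_norm _
      _ = ‖k z‖ * ‖φ z‖ * ‖W z‖ ^ 2 := by rw [norm_mul, norm_mul, norm_pow]; ring
      _ ≤ (‖A‖ + 1) * (‖φ p‖ + 1) * ‖W z‖ ^ 2 := by gcongr
  · have h1 : Tendsto W (𝓝[≠] p) (𝓝 0) := by
      have := hWc.continuousAt.tendsto
      rw [hWp] at this
      exact this.mono_left nhdsWithin_le_nhds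
    have h2 : ∀ᶠ z in 𝓝[≠] p, z ∈ U \ {p} := by
      filter_upwards [mem_nhdsWithin_of_mem_nhds (hUo.mem_nhds hpU), self_mem_nhdsWithin]
        with z h h'
      exact ⟨h, h'⟩
    have h3 : Tendsto (fun z => ‖W z‖ ^ 2) (𝓝[≠] p) (𝓝[>] 0) := by
      apply tendsto_nhdsWithin_of_tendsto_nhds_of_eventually_within
      · simpa using h1.norm.pow 2
      · filter_upwards [h2] with z hz
        have := norm_pos_iff.2 (hW0 z hz)
        exact pow_pos this 2
    refine (tendsto_inv_nhdsGT_zero.comp h3).congr' ?_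
    filter_upwards [h2] with z hz
    exact (hr2 z hz).symm

end RiemannType

/-- The Laurent expansion of an even function with a double pole has no residue. -/
theorem exists_laurent_of_even {u : ℂ → ℂ} {p : ℂ} (hu : meromorphicOrderAt u p = -2)
    (heven : ∀ z, u (2 * p - z) = u z) : ∃ a : ℂ, a ≠ 0 ∧ ∃ k : ℂ → ℂ, AnalyticAt ℂ k p ∧
      ∀ᶠ z in 𝓝[≠] p, u z = a / (z - p) ^ 2 + k z := by
  have hm : MeromorphicAt u p := meromorphicAt_of_meromorphicOrderAt_ne_zero (by rw [hu]; decide)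
  obtain ⟨k, hk, hk0, hE⟩ := (meromorphicOrderAt_eq_int_iff hm (n := -2)).1 hu
  have e1 : 2 * p - p = p := by ring
  have hk' : AnalyticAt ℂ (fun z => k (2 * p - z)) p :=
    AnalyticAt.comp (g := k) (by rwa [e1]) (by fun_prop)
  have ht : Tendsto (fun z => 2 * p - z) (𝓝[≠] p) (𝓝[≠] p) := by
    apply tendsto_nhdsWithin_of_tendsto_nhds_of_eventually_within
    · have : Continuous fun z : ℂ => 2 * p - z := by fun_prop
      exact (this.tendsto' p p e1).mono_left nhdsWithin_le_nhds
    · filter_upwards [self_mem_nhdsWithin] with z hz hzp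
      refine hz ?_
      rw [mem_singleton_iff] at hzp ⊢
      linear_combination -hzp
  have hsym : ∀ᶠ z in 𝓝[≠] p, k (2 * p - z) = k z := by
    filter_upwards [hE, ht.eventually hE, self_mem_nhdsWithin] with z h1 h2 h3
    rw [heven, h1] at h2
    have h4 : z - p ≠ 0 := sub_ne_zero.2 h3
    have h5 : 2 * p - z - p = -(z - p) := by ring
    rw [h5, smul_eq_mul, smul_eq_mul, Even.neg_zpow (by decide)] at h2
    exact (mul_left_cancel₀ (zpow_ne_zero _ h4) h2).symm
  -- The factor `k` inherits the evenness of `u`, so its linear coefficient, which is the residue,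
  -- vanishes.
  have hd : deriv k p = 0 := by
    have h0 : (fun z => k (2 * p - z)) =ᶠ[𝓝 p] k :=
      (hk'.frequently_eq_iff_eventually_eq hk).1 hsym.frequently
    have h1 := h0.deriv_eq
    rw [deriv_comp_const_sub, e1] at h1
    linear_combination (-1 / 2) * h1
  have hk1 : AnalyticAt ℂ (dslope k p) p := by
    obtain ⟨P, hP⟩ := hk
    exact ⟨_, hP.has_fpower_series_dslope_fslope⟩
  have hk2 : AnalyticAt ℂ (dslope (dslope k p) p) p := by
    obtain ⟨P, hP⟩ := hk1
    exact ⟨_, hP.has_fpower_series_dslope_fslope⟩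
  refine ⟨k p, hk0, _, hk2, ?_⟩
  filter_upwards [hE, self_mem_nhdsWithin] with z h1 h3
  have h4 : z - p ≠ 0 := sub_ne_zero.2 h3
  have h5 := sub_smul_dslope k p z
  have h6 := sub_smul_dslope (dslope k p) p z
  rw [dslope_same, hd, sub_zero] at h6
  rw [← h6, smul_eq_mul, smul_eq_mul] at h5
  rw [h1, smul_eq_mul, zpow_neg, zpow_ofNat]
  field_simp
  linear_combination -h5

/-- Functions with the same real differential on a punctured disk differ by a constant. -/
theorem exists_sub_eq_const_of_hasFDerivAt {S R : ℂ → ℝ} {A : ℂ → ℂ →L[ℝ] ℝ} {p : ℂ} {r : ℝ}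
    (hr : 0 < r) (hS : ∀ z ∈ Metric.ball p r \ {p}, HasFDerivAt S (A z) z)
    (hR : ∀ z ∈ Metric.ball p r \ {p}, HasFDerivAt R (A z) z) :
    ∃ κ, ∀ z ∈ Metric.ball p r \ {p}, S z = R z + κ := by
  have hd : ∀ z ∈ Metric.ball p r \ {p}, HasFDerivAt (fun z => S z - R z) (0 : ℂ →L[ℝ] ℝ) z := by
    intro z hz
    have := (hS z hz).sub (hR z hz)
    rwa [sub_self] at this
  obtain ⟨κ, hκ⟩ := (Metric.isOpen_ball.sdiff isClosed_singleton).exists_is_const_of_fderiv_eq_zero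
    (𝕜 := ℝ) (isPreconnected_ball_diff_center p hr)
    (fun z hz => (hd z hz).differentiableAt.differentiableWithinAt) (fun z hz => (hd z hz).fderiv)
  exact ⟨κ, fun z hz => by rw [← hκ z hz]; ring⟩

namespace RiemannType
variable {g : Cyl → ℂ} {X : Cyl → E3} {β c e : ℂ}

/-- Without a residue, `u` has the single-valued primitive -a/(z - p) + K. If V is a primitive of
`v`, the horizontal projection is half of this primitive minus half of conj V, up to constants: a
simple pole plus a function that is smooth over ℝ but not holomorphic. -/
theorem isPlanarEnd_of_hasFDerivAt {Y : ℂ → E3} {p a : ℂ} (ha : a ≠ 0) {u v k : ℂ → ℂ}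
    (hu : ∀ᶠ z in 𝓝[≠] p, u z = a / (z - p) ^ 2 + k z) (hk : AnalyticAt ℂ k p)
    (hv : AnalyticAt ℂ v p) (T : E3 ≃ₗᵢ[ℝ] E3) {b : ℝ}
    (hcont : ∀ᶠ z in 𝓝[≠] p, ContinuousAt Y z)
    (h0 : ∀ᶠ z in 𝓝[≠] p, HasFDerivAt (fun ζ => T (Y ζ) 0)
      (Complex.reCLM.comp (((1 / 2) * (u z - v z)) • ContinuousLinearMap.id ℝ ℂ)) z)
    (h1 : ∀ᶠ z in 𝓝[≠] p, HasFDerivAt (fun ζ => T (Y ζ) 1)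
      (Complex.reCLM.comp (((-Complex.I / 2) * (u z + v z)) • ContinuousLinearMap.id ℝ ℂ)) z)
    (hh : ∀ᶠ z in 𝓝[≠] p, T (Y z) 2 = z.re + b) : IsPlanarEnd Y p := by
  have hev : ∀ᶠ z in 𝓝 p, AnalyticAt ℂ k z ∧ AnalyticAt ℂ v z ∧ (z ≠ p →
      u z = a / (z - p) ^ 2 + k z ∧ HasFDerivAt (fun ζ => T (Y ζ) 0)
      (Complex.reCLM.comp (((1 / 2) * (u z - v z)) • ContinuousLinearMap.id ℝ ℂ)) z ∧
      HasFDerivAt (fun ζ => T (Y ζ) 1)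
      (Complex.reCLM.comp (((-Complex.I / 2) * (u z + v z)) • ContinuousLinearMap.id ℝ ℂ)) z) := by
    filter_upwards [hk.eventually_analyticAt, hv.eventually_analyticAt,
      eventually_nhdsWithin_iff.1 (hu.and (h0.and h1))] with z h2 h3 h4
    exact ⟨h2, h3, h4⟩
  obtain ⟨r, hr, hball⟩ := Metric.mem_nhds_iff.1 hev
  obtain ⟨K, hK⟩ := DifferentiableOn.isExactOn_ball (f := k) (c := p) (r := r)
    (fun z hz => (hball hz).1.differentiableAt.differentiableWithinAt)
  obtain ⟨V, hV⟩ := DifferentiableOn.isExactOn_ball (f := v) (c := p) (r := r)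
    (fun z hz => (hball hz).2.1.differentiableAt.differentiableWithinAt)
  have hF : ∀ z ∈ Metric.ball p r \ {p}, HasDerivAt (fun z => -a / (z - p) + K z) (u z) z := by
    intro z hz
    have hzp : z - p ≠ 0 := sub_ne_zero.2 hz.2
    rw [((hball hz.1).2.2 hz.2).1]
    have e1 := (hasDerivAt_const z (-a)).div ((hasDerivAt_id z).sub_const p) hzp
    convert! e1.add (hK z hz.1) using 1
    simp
  obtain ⟨κ₀, hκ₀⟩ := exists_sub_eq_const_of_hasFDerivAt hr
    (fun z hz => ((hball hz.1).2.2 hz.2).2.1)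
    (fun z hz => hasFDerivAt_re_comp (((hF z hz).sub (hV z hz.1)).const_mul (1 / 2)))
  obtain ⟨κ₁, hκ₁⟩ := exists_sub_eq_const_of_hasFDerivAt hr
    (fun z hz => ((hball hz.1).2.2 hz.2).2.2)
    (fun z hz => hasFDerivAt_re_comp (((hF z hz).add (hV z hz.1)).const_mul (-Complex.I / 2)))
  have hKa : AnalyticAt ℂ K p := DifferentiableOn.analyticAt
    (fun z hz => (hK z hz).differentiableAt.differentiableWithinAt) (Metric.ball_mem_nhds p hr)
  have hVa : AnalyticAt ℂ V p := DifferentiableOn.analyticAt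
    (fun z hz => (hV z hz).differentiableAt.differentiableWithinAt) (Metric.ball_mem_nhds p hr)
  have hφ : ContDiffAt ℝ 1 (fun z => (1 / 2) * K z - (1 / 2) * (starRingEnd ℂ) (V z)
      + (κ₀ + κ₁ * Complex.I)) p := by
    have c1 : ContDiffAt ℝ 1 K p := hKa.contDiffAt.restrict_scalars ℝ
    have c2 : ContDiffAt ℝ 1 V p := hVa.contDiffAt.restrict_scalars ℝ
    have c3 : ContDiffAt ℝ 1 (fun z => (starRingEnd ℂ) (V z)) p :=
      Complex.conjCLE.contDiff.contDiffAt.comp p c2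
    fun_prop
  refine isPlanarEnd_of_expansion (A := -a / 2) (by simpa using ha) hφ T hcont ?_ hh
  filter_upwards [mem_nhdsWithin_of_mem_nhds (Metric.ball_mem_nhds p hr), self_mem_nhdsWithin]
    with z hz hzp
  have hzp' : z - p ≠ 0 := sub_ne_zero.2 hzp
  rw [hκ₀ z ⟨hz, hzp⟩, hκ₁ z ⟨hz, hzp⟩]
  have e2 : -a / 2 / (z - p) = (1 / 2) * (-a / (z - p)) := by ring
  simp only [Pi.sub_apply, Pi.add_apply, e2]
  generalize -a / (z - p) = q
  apply Complex.ext
  · simp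
    ring
  · simp
    ring

/-- Change of sign of the coordinates with the given signs. -/
noncomputable def coordinateSigns (s : Fin 3 → (ℝ ≃ₗᵢ[ℝ] ℝ)) : E3 ≃ₗᵢ[ℝ] E3 :=
  LinearIsometryEquiv.piLpCongrRight 2 s

theorem eventually_nhdsNE_mem_regularSet (h : DoubleElliptic β c e (lift g)) (p : ℂ) :
    ∀ᶠ z in 𝓝[≠] p, z ∈ regularSet g := by
  filter_upwards [(meromorphicOrderAt_ne_top_iff_eventually_ne_zero
    (h.nf.meromorphicOn p (mem_univ p))).1 (h.order_ne_top p)] with z hz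
  exact h.ne_zero_iff.1 hz

theorem continuousAt_lift (hX : HasWeierstrassPair g X) {z : ℂ} (hz : z ∈ regularSet g) :
    ContinuousAt (lift X) z := by
  have : DifferentiableAt ℝ (lift X) z := by
    rw [differentiableAt_euclidean]
    exact fun j => (hX z (mem_puncturedCyl_iff.2 hz) j).differentiableAt
  exact this.continuousAt

theorem exists_height (h : DoubleElliptic β c e (lift g)) (hX : HasWeierstrassPair g X) :
    ∃ b, ∀ z ∈ regularSet g, lift X z 2 = z.re + b := by
  obtain ⟨z₀, hz₀⟩ := h.isConnected_regular.nonempty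
  refine ⟨X (z₀ : Cyl) 2 - z₀.re, fun z hz => ?_⟩
  have := height_sub h hX hz hz₀
  simp only [lift]
  linarith

theorem isPlanarEnd_zero (h : DoubleElliptic β c e (lift g)) (hX : HasWeierstrassPair g X) {p : ℂ}
    (hp : meromorphicOrderAt (lift g) p = 2) : IsPlanarEnd (lift X) p := by
  obtain ⟨a, ha, k, hk, hu⟩ := exists_laurent_of_even (u := (lift g)⁻¹) (p := p)
    (by rw [meromorphicOrderAt_inv, hp]) (fun z => by simp [h.reflection hp z])
  obtain ⟨b, hb⟩ := exists_height h hX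
  have hreg := eventually_nhdsNE_mem_regularSet h p
  refine isPlanarEnd_of_hasFDerivAt ha hu hk (v := lift g) (h.analyticAt (by rw [hp]; decide))
    -- Changing the sign of x₂ makes the part from 1/g, which carries the pole, holomorphic in x₁ +
    -- i x₂.
    (coordinateSigns ![LinearIsometryEquiv.refl ℝ ℝ, LinearIsometryEquiv.neg ℝ,
      LinearIsometryEquiv.refl ℝ ℝ]) (b := b) ?_ ?_ ?_ ?_
  · exact hreg.mono fun z hz => continuousAt_lift hX hz
  · refine hreg.mono fun z hz => ?_
    have := hX z (mem_puncturedCyl_iff.2 hz) 0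
    rw [weierstrassForm_zero, one_div (lift g z)] at this
    exact this
  · refine hreg.mono fun z hz => ?_
    have := (hX z (mem_puncturedCyl_iff.2 hz) 1).neg
    rw [weierstrassForm_one, one_div (lift g z)] at this
    convert! this using 1
    ext u
    simp
    ring
  · exact hreg.mono fun z hz => hb z hz

theorem isPlanarEnd_pole (h : DoubleElliptic β c e (lift g)) (hX : HasWeierstrassPair g X) {q : ℂ}
    (hp : meromorphicOrderAt (lift g) q = -2) : IsPlanarEnd (lift X) q := by
  have hinv : meromorphicOrderAt (lift g)⁻¹ q = 2 := by
    rw [meromorphicOrderAt_inv, hp]; rfl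
  obtain ⟨a, ha, k, hk, hu⟩ := exists_laurent_of_even (u := lift g) (p := q) hp
    (fun z => inv_injective (h.inv.reflection hinv z))
  obtain ⟨b, hb⟩ := exists_height h hX
  have hreg := eventually_nhdsNE_mem_regularSet h q
  refine isPlanarEnd_of_hasFDerivAt ha hu hk (v := (lift g)⁻¹)
    (h.inv.analyticAt (by rw [hinv]; decide))
    -- At a pole of `g` the roles of g and 1/g are exchanged, which costs a further sign in x₁.
    (coordinateSigns ![LinearIsometryEquiv.neg ℝ, LinearIsometryEquiv.neg ℝ,
      LinearIsometryEquiv.refl ℝ ℝ]) (b := b) ?_ ?_ ?_ ?_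
  · exact hreg.mono fun z hz => continuousAt_lift hX hz
  · refine hreg.mono fun z hz => ?_
    have := (hX z (mem_puncturedCyl_iff.2 hz) 0).neg
    rw [weierstrassForm_zero, one_div (lift g z)] at this
    convert! this using 1
    ext u
    simp
    ring
  · refine hreg.mono fun z hz => ?_
    have := (hX z (mem_puncturedCyl_iff.2 hz) 1).neg
    rw [weierstrassForm_one, one_div (lift g z)] at this
    convert! this using 1
    ext u
    simp
    ring
  · exact hreg.mono fun z hz => hb z hz

end RiemannType

/-! ### Spherical area, lattice bases and surjectivity. -/

/-- The density of the area of the sphere under stereographic projection. -/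
noncomputable def sphereDensity (w : ℂ) : ℝ := 4 / (1 + Complex.normSq w) ^ 2

theorem sphereDensity_nonneg (w : ℂ) : 0 ≤ sphereDensity w := by
  unfold sphereDensity; positivity

/-- The density of the pull back of the area of the sphere. -/
noncomputable def pullbackDensity (f : ℂ → ℂ) (z : ℂ) : ℝ :=
  Complex.normSq (deriv f z) * sphereDensity (f z)

theorem pullbackDensity_nonneg (f : ℂ → ℂ) (z : ℂ) : 0 ≤ pullbackDensity f z :=
  mul_nonneg (Complex.normSq_nonneg _) (sphereDensity_nonneg _)

theorem continuous_sphereDensity : Continuous sphereDensity := by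
  unfold sphereDensity
  refine continuous_const.div ((continuous_const.add Complex.continuous_normSq).pow 2) fun w => ?_
  have := Complex.normSq_nonneg w
  positivity

theorem integral_sphereDensity : ∫ w, sphereDensity w = 4 * Real.pi := by
  rw [← Complex.integral_comp_polarCoord_symm]
  have h1 : ∀ q : ℝ × ℝ, q.1 • sphereDensity (Complex.polarCoord.symm q) =
      (4 * q.1 / (1 + q.1 ^ 2) ^ 2) * 1 := by
    intro q
    rw [sphereDensity, Complex.normSq_eq_norm_sq, Complex.norm_polarCoord_symm, sq_abs, smul_eq_mul]
    ring
  simp only [h1]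
  rw [polarCoord_target, Measure.volume_eq_prod, setIntegral_prod_mul
    (fun r : ℝ => 4 * r / (1 + r ^ 2) ^ 2) (fun _ : ℝ => (1 : ℝ))]
  have h2 : ∫ r in Ioi (0 : ℝ), 4 * r / (1 + r ^ 2) ^ 2 = 0 - (-2 / (1 + (0 : ℝ) ^ 2)) := by
    refine integral_Ioi_of_hasDerivAt_of_nonneg' (g := fun r : ℝ => -2 / (1 + r ^ 2))
      (fun r _ => ?_) (fun r hr => ?_) ?_
    · have h3 : (1 : ℝ) + r ^ 2 ≠ 0 := by positivity
      have := (hasDerivAt_const r (-2 : ℝ)).div (((hasDerivAt_id r).pow 2).const_add 1) h3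
      convert! this using 1
      simp
      ring
    · have : (0 : ℝ) < r := hr
      positivity
    · refine Tendsto.const_div_atTop ?_ _
      exact tendsto_atTop_add_const_left _ _ (tendsto_pow_atTop two_ne_zero)
  rw [h2]
  have h4 : volume.real (Ioo (-Real.pi) Real.pi) = 2 * Real.pi := by
    rw [measureReal_def, Real.volume_Ioo, ENNReal.toReal_ofReal (by linarith [Real.pi_pos])]
    ring
  simp [h4]
  ring

theorem lintegral_sphereDensity :
    ∫⁻ w, ENNReal.ofReal (sphereDensity w) = ENNReal.ofReal (4 * Real.pi) := by
  have hint : Integrable sphereDensity := by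
    by_contra h
    have := integral_sphereDensity
    rw [integral_undef h] at this
    linarith [Real.pi_pos]
  rw [← integral_sphereDensity, ofReal_integral_eq_lintegral_ofReal hint
    (Eventually.of_forall sphereDensity_nonneg)]

theorem det_restrictScalars_smulRight (d : ℂ) :
    ((ContinuousLinearMap.toSpanSingleton ℂ d).restrictScalars ℝ).det = Complex.normSq d := by
  rw [ContinuousLinearMap.det]
  have := LinearMap.det_restrictScalars (R := ℝ) (S := ℂ) (A := ℂ)
    (f := (ContinuousLinearMap.toSpanSingleton ℂ d : ℂ →ₗ[ℂ] ℂ))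
  rw [Algebra.norm_complex_apply] at this
  have h1 : LinearMap.det (ContinuousLinearMap.toSpanSingleton ℂ d : ℂ →ₗ[ℂ] ℂ) = d := by
    rw [LinearMap.det_ring]
    simp
  rw [h1] at this
  exact this

/-- Area formula for an injective holomorphic map. -/
theorem lintegral_image_holomorphic {f : ℂ → ℂ} {s : Set ℂ} (hs : MeasurableSet s)
    (hf : ∀ z ∈ s, DifferentiableAt ℂ f z) (hinj : InjOn f s) (G : ℂ → ENNReal) :
    ∫⁻ w in f '' s, G w = ∫⁻ z in s, ENNReal.ofReal (Complex.normSq (deriv f z)) * G (f z) := by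
  rw [lintegral_image_eq_lintegral_abs_det_fderiv_mul volume hs
    (f' := fun z => (ContinuousLinearMap.toSpanSingleton ℂ (deriv f z)).restrictScalars ℝ)
    (fun z hz => ((hf z hz).hasDerivAt.hasFDerivAt.restrictScalars ℝ).hasFDerivWithinAt) hinj]
  simp only [det_restrictScalars_smulRight, abs_of_nonneg (Complex.normSq_nonneg _)]

theorem volume_line_eq_zero {φ : ℂ →ₗ[ℝ] ℝ} (hφ : φ ≠ 0) (c : ℝ) :
    volume {z : ℂ | φ z = c} = 0 := by
  obtain ⟨x, hx⟩ : ∃ x, φ x ≠ 0 := by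
    by_contra! h
    exact hφ (LinearMap.ext h)
  have h0 : φ ((c / φ x) • x) = c := by
    rw [map_smul, smul_eq_mul, div_mul_cancel₀ _ hx]
  have h1 : {z : ℂ | φ z = c} = (AffineSubspace.mk' ((c / φ x) • x) (LinearMap.ker φ) : Set ℂ) := by
    ext z
    rw [mem_ofPred_eq, SetLike.mem_coe, AffineSubspace.mem_mk', LinearMap.mem_ker, vsub_eq_sub,
      map_sub, h0, sub_eq_zero]
  rw [h1]
  apply Measure.addHaar_affineSubspace
  intro h2
  have h3 := congrArg AffineSubspace.direction h2
  rw [AffineSubspace.direction_mk', AffineSubspace.direction_top] at h3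
  exact hφ (LinearMap.ker_eq_top.1 h3)

theorem exists_lattice_basis {L : AddSubgroup ℂ} [hd : DiscreteTopology L]
    (hspan : Submodule.span ℝ (L : Set ℂ) = ⊤) :
    ∃ b : Module.Basis (Fin 2) ℝ ℂ, (Submodule.span ℤ (range b)).toAddSubgroup = L := by
  let L' : Submodule ℤ ℂ := AddSubgroup.toIntSubmodule L
  have : DiscreteTopology L' := hd
  have : IsZLattice ℝ L' := ⟨hspan⟩
  have := ZLattice.module_finite ℝ L'
  have := ZLattice.module_free ℝ L'
  have hr : Module.finrank ℤ L' = 2 := by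
    rw [ZLattice.rank ℝ L', Complex.finrank_real_complex]
  let b := Module.finBasisOfFinrankEq ℤ L' hr
  refine ⟨b.ofZLatticeBasis ℝ L', ?_⟩
  rw [Module.Basis.ofZLatticeBasis_span]
  rfl

theorem isBounded_range_of_periodic {L : AddSubgroup ℂ} {b : Module.Basis (Fin 2) ℝ ℂ}
    (hb : (Submodule.span ℤ (range b)).toAddSubgroup = L) {k : ℂ → ℂ} (hk : Continuous k)
    (hper : ∀ l ∈ L, ∀ z, k (z + l) = k z) : Bornology.IsBounded (range k) := by
  have h1 : IsCompact (closure (ZSpan.fundamentalDomain b)) :=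
    (ZSpan.fundamentalDomain_isBounded b).isCompact_closure
  refine (h1.image hk).isBounded.subset ?_
  rintro _ ⟨z, rfl⟩
  refine ⟨ZSpan.fract b z, subset_closure (ZSpan.fract_mem_fundamentalDomain b z), ?_⟩
  have h2 : ((ZSpan.floor b z : _) : ℂ) ∈ L := by
    rw [← hb]
    exact (ZSpan.floor b z).2
  rw [← hper _ h2, ZSpan.fract_apply, sub_add_cancel]

namespace DoubleElliptic
variable {β c e : ℂ} {f : ℂ → ℂ}

/-- An elliptic function takes every nonzero complex value. -/
theorem exists_apply_eq (h : DoubleElliptic β c e f) {b : Module.Basis (Fin 2) ℝ ℂ}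
    (hb : (Submodule.span ℤ (range b)).toAddSubgroup = periodGroup f) {w : ℂ} (hw : w ≠ 0) :
    ∃ z, meromorphicOrderAt f z = 0 ∧ f z = w := by
  by_contra! hcon
  classical
  obtain ⟨p, hp⟩ := h.exists_zero
  have hne : ∀ z, 0 ≤ meromorphicOrderAt f z → f z - w ≠ 0 := by
    intro z hz
    rcases h.order z with h1 | h1 | h1
    · exact sub_ne_zero.2 (hcon z h1)
    · rw [h.apply_zero h1, zero_sub, neg_ne_zero]; exact hw
    · rw [h1] at hz
      exact absurd hz (by decide)
  let k : ℂ → ℂ := fun z => if meromorphicOrderAt f z = -2 then 0 else (f z - w)⁻¹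
  have hpole : ∀ z, ¬ 0 ≤ meromorphicOrderAt f z → meromorphicOrderAt f z = -2 := by
    intro z hz
    rcases h.order z with h1 | h1 | h1
    · exact absurd h1.ge hz
    · rw [h1] at hz
      exact absurd (by decide) hz
    · exact h1
  have hreg : ∀ z, 0 ≤ meromorphicOrderAt f z → k =ᶠ[𝓝 z] fun z => (f z - w)⁻¹ := by
    intro z hz
    filter_upwards [(h.analyticAt hz).eventually_analyticAt] with y hy
    have := hy.meromorphicOrderAt_nonneg
    simp only [k]
    rw [if_neg]
    intro h1
    rw [h1] at this
    exact absurd this (by decide)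
  have hdiff : ∀ z, 0 ≤ meromorphicOrderAt f z → DifferentiableAt ℂ k z := by
    intro z hz
    refine DifferentiableAt.congr_of_eventuallyEq ?_ (hreg z hz)
    exact ((h.analyticAt hz).differentiableAt.sub_const w).inv (hne z hz)
  have hent : Differentiable ℂ k := by
    intro z
    by_cases hz : 0 ≤ meromorphicOrderAt f z
    · exact hdiff z hz
    · have hz2 := hpole z hz
      have hne0 := (meromorphicOrderAt_ne_top_iff_eventually_ne_zero
        (h.nf.meromorphicOn z (mem_univ z))).1 (h.order_ne_top z)
      refine (Complex.analyticAt_of_differentiable_on_punctured_nhds_of_continuousAt ?_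
        ?_).differentiableAt
      · filter_upwards [hne0] with y hy
        exact hdiff y (h.ne_zero_iff.1 hy).ge
      · rw [continuousAt_iff_punctured_nhds]
        have hk0 : k z = 0 := if_pos hz2
        rw [hk0]
        have h1 : Tendsto f (𝓝[≠] z) (Bornology.cobounded ℂ) :=
          tendsto_cobounded_of_meromorphicOrderAt_neg (by rw [hz2]; decide)
        have h2 : Tendsto (fun y => f y - w) (𝓝[≠] z) (Bornology.cobounded ℂ) := by
          rw [← tendsto_norm_atTop_iff_cobounded] at h1 ⊢
          refine tendsto_atTop_mono (fun y => ?_) (tendsto_atTop_add_const_right _ (-‖w‖) h1)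
          have := norm_sub_norm_le (f y) w
          linarith
        refine (tendsto_inv₀_cobounded.comp h2).congr' ?_
        filter_upwards [hne0] with y hy
        simp only [k, Function.comp]
        rw [if_neg]
        rw [h.ne_zero_iff.1 hy]
        decide
  have hbd : Bornology.IsBounded (range k) := by
    refine isBounded_range_of_periodic hb hent.continuous fun l hl z => ?_
    simp only [k, meromorphicOrderAt_add_period hl, hl z]
  obtain ⟨q, hq⟩ := h.exists_pole
  have h1 := hent.apply_eq_apply_of_bounded hbd p q
  simp only [k] at h1
  rw [if_pos hq, if_neg (by rw [hp]; decide)] at h1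
  exact hne p (by rw [hp]; decide) (inv_eq_zero.1 h1)

end DoubleElliptic

/-! ### Fundamental parallelograms and the degree two count. -/

section Parallelogram
variable (b : Module.Basis (Fin 2) ℝ ℂ) (p : ℂ)

/-- Half of the open fundamental parallelogram of a basis with corner `p`. -/
def halfCell : Set ℂ := {z | b.coord 0 (z - p) ∈ Ioo 0 1 ∧ b.coord 1 (z - p) ∈ Ioo 0 (1 / 2)}

/-- The fundamental parallelogram of a basis with corner `p`. -/
def cell : Set ℂ := {z | b.coord 0 (z - p) ∈ Ico 0 1 ∧ b.coord 1 (z - p) ∈ Ico 0 1}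

/-- The lines bounding the two halves of the fundamental parallelogram. -/
def cellLines : Set ℂ :=
  {z | b.coord 0 (z - p) = 0} ∪ {z | b.coord 1 (z - p) = 0} ∪ {z | b.coord 1 (z - p) = 1 / 2}

variable {b p}

theorem continuous_coord_sub (i : Fin 2) : Continuous fun z => b.coord i (z - p) :=
  (b.coord i).continuous_of_finiteDimensional.comp (by fun_prop)

theorem measurableSet_halfCell : MeasurableSet (halfCell b p) :=
  ((isOpen_Ioo.preimage (continuous_coord_sub 0)).inter
    (isOpen_Ioo.preimage (continuous_coord_sub 1))).measurableSet

theorem volume_cellLines : volume (cellLines b p) = 0 := by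
  have h : ∀ i c, volume {z | b.coord i (z - p) = c} = 0 := by
    intro i c
    have hi : b.coord i ≠ 0 := by
      intro h0
      have := b.coord_apply i (b i)
      rw [h0] at this
      simp at this
    rw [← volume_line_eq_zero hi (c + b.coord i p)]
    congr 1
    ext z
    rw [mem_ofPred_eq, mem_ofPred_eq, map_sub, sub_eq_iff_eq_add]
  simp only [cellLines, measure_union_null_iff, h, and_self]

/-- The reflection about the centre of the cell exchanges its two halves; it preserves `f` when `p`
is a zero and the basis consists of periods. -/
theorem coord_reflection (i : Fin 2) (z : ℂ) :
    b.coord i (2 * p + b 0 + b 1 - z - p) = 1 - b.coord i (z - p) := by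
  have h1 : b.coord i (b 0 + b 1) = 1 := by
    fin_cases i <;> simp
  rw [show 2 * p + b 0 + b 1 - z - p = (b 0 + b 1) - (z - p) by ring, map_sub, h1]

theorem mem_cell_cases {z : ℂ} (hz : z ∉ cellLines b p) : z ∈ cell b p ↔
    z ∈ halfCell b p ∪ (fun z => 2 * p + b 0 + b 1 - z) ⁻¹' halfCell b p := by
  simp only [cellLines, mem_union, mem_ofPred_eq, not_or] at hz
  obtain ⟨⟨h0, h1⟩, h2⟩ := hz
  simp only [cell, halfCell, mem_union, mem_preimage, mem_ofPred_eq, coord_reflection, mem_Ioo,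
    mem_Ico]
  constructor
  · rintro ⟨⟨a1, a2⟩, a3, a4⟩
    rcases lt_or_gt_of_ne h2 with h | h
    · exact Or.inl ⟨⟨lt_of_le_of_ne a1 (Ne.symm h0), a2⟩, lt_of_le_of_ne a3 (Ne.symm h1), h⟩
    · have := lt_of_le_of_ne a1 (Ne.symm h0)
      refine Or.inr ⟨⟨?_, ?_⟩, ?_, ?_⟩ <;> linarith
  · rintro (⟨⟨a1, a2⟩, a3, a4⟩ | ⟨⟨a1, a2⟩, a3, a4⟩) <;>
      refine ⟨⟨?_, ?_⟩, ?_, ?_⟩ <;> linarith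

open scoped Pointwise in
theorem isAddFundamentalDomain_cell {L : AddSubgroup ℂ}
    (hb : (Submodule.span ℤ (range b)).toAddSubgroup = L) :
    IsAddFundamentalDomain L (cell b p) volume := by
  subst hb
  have : cell b p = p +ᵥ ZSpan.fundamentalDomain b := by
    ext z
    rw [mem_vadd_set_iff_neg_vadd_mem, ZSpan.mem_fundamentalDomain, Fin.forall_fin_two,
      vadd_eq_add, neg_add_eq_sub]
    rfl
  rw [this]
  exact (ZSpan.isAddFundamentalDomain' b volume).vadd_of_comm p

theorem coord_mem_of_mem {L : AddSubgroup ℂ}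
    (hb : (Submodule.span ℤ (range b)).toAddSubgroup = L) {l : ℂ} (hl : l ∈ L) (i : Fin 2) :
    ∃ n : ℤ, b.coord i l = n := by
  subst hb
  obtain ⟨n, hn⟩ := (b.mem_span_iff_repr_mem ℤ l).1 hl i
  exact ⟨n, by simpa using hn.symm⟩

theorem basis_mem {L : AddSubgroup ℂ}
    (hb : (Submodule.span ℤ (range b)).toAddSubgroup = L) (i : Fin 2) : b i ∈ L := by
  subst hb
  exact Submodule.subset_span (mem_range_self i)

theorem exists_add_mem_cell {L : AddSubgroup ℂ}
    (hb : (Submodule.span ℤ (range b)).toAddSubgroup = L) (z : ℂ) : ∃ l ∈ L, z + l ∈ cell b p := by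
  subst hb
  refine ⟨-(ZSpan.floor b (z - p) : ℂ), neg_mem (ZSpan.floor b (z - p)).2, ?_⟩
  have := ZSpan.fract_mem_fundamentalDomain b (z - p)
  rw [ZSpan.mem_fundamentalDomain, Fin.forall_fin_two, ZSpan.fract_apply,
    show z - p - (ZSpan.floor b (z - p) : ℂ) = z + -(ZSpan.floor b (z - p) : ℂ) - p by ring] at this
  exact this

end Parallelogram

namespace DoubleElliptic
variable {β c e : ℂ} {f : ℂ → ℂ} {b : Module.Basis (Fin 2) ℝ ℂ} {p : ℂ}

/-- Equal values force w - z or z + w - 2p to be a period, and periods have integer coordinates. The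
first is then zero; the second is impossible because its second coordinate lies strictly between 0
and 1, which is why the cell is halved. -/
theorem injOn_halfCell (h : DoubleElliptic β c e f)
    (hb : (Submodule.span ℤ (range b)).toAddSubgroup = periodGroup f)
    (hp : meromorphicOrderAt f p = 2) :
    InjOn f (halfCell b p ∩ {z | meromorphicOrderAt f z = 0}) := by
  rintro z ⟨⟨⟨z1, z2⟩, z3, z4⟩, hz⟩ w ⟨⟨⟨w1, w2⟩, w3, w4⟩, hw⟩ hE
  rcases h.mem_of_apply_eq hp (le_of_eq hz.symm) (le_of_eq hw.symm) hE with h1 | h1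
  · have key : ∀ i, |b.coord i (w - p) - b.coord i (z - p)| < 1 →
        b.coord i (w - p) = b.coord i (z - p) := by
      intro i hi
      obtain ⟨n, hn⟩ := coord_mem_of_mem hb h1 i
      rw [show w - z = w - p - (z - p) by ring, map_sub] at hn
      rw [hn, ← Int.cast_abs, ← Int.cast_one, Int.cast_lt, Int.abs_lt_one_iff] at hi
      rw [hi, Int.cast_zero, sub_eq_zero] at hn
      exact hn
    have h2 : z - p = w - p := by
      refine b.ext_elem fun i => ?_
      fin_cases i
      · exact (key 0 (abs_lt.2 ⟨by linarith, by linarith⟩)).symm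
      · exact (key 1 (abs_lt.2 ⟨by linarith, by linarith⟩)).symm
    exact sub_left_injective h2
  · exfalso
    obtain ⟨n, hn⟩ := coord_mem_of_mem hb h1 1
    rw [show z + w - 2 * p = z - p + (w - p) by ring, map_add] at hn
    have h2 : (0 : ℝ) < n := by linarith
    have h3 : (n : ℝ) < 1 := by linarith
    have h4 : (0 : ℤ) < n := by exact_mod_cast h2
    have h5 : n < 1 := by exact_mod_cast h3
    omega

theorem apply_reflection (h : DoubleElliptic β c e f)
    (hb : (Submodule.span ℤ (range b)).toAddSubgroup = periodGroup f)
    (hp : meromorphicOrderAt f p = 2) (z : ℂ) : f (2 * p + b 0 + b 1 - z) = f z := by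
  rw [show 2 * p + b 0 + b 1 - z = 2 * p - z + (b 0 + b 1) by ring,
    add_mem (basis_mem hb 0) (basis_mem hb 1), h.reflection hp]

/-- Every nonzero value is taken in the closed-open cell, and the reflection moves the preimage to
the chosen half unless it lies on the dividing lines. The image of those lines is null. -/
theorem image_halfCell (h : DoubleElliptic β c e f)
    (hb : (Submodule.span ℤ (range b)).toAddSubgroup = periodGroup f)
    (hp : meromorphicOrderAt f p = 2) :
    f '' (halfCell b p ∩ {z | meromorphicOrderAt f z = 0}) =ᵐ[volume] univ := by
  have hnull : volume (f '' (cellLines b p ∩ {z | meromorphicOrderAt f z = 0})) = 0 := by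
    refine addHaar_image_eq_zero_of_differentiableOn_of_addHaar_eq_zero volume (fun z hz => ?_)
      (measure_mono_null inter_subset_left volume_cellLines)
    exact ((h.analyticAt (le_of_eq hz.2.symm)).differentiableAt.restrictScalars
      ℝ).differentiableWithinAt
  rw [eventuallyEq_univ, mem_ae_iff]
  refine measure_mono_null ?_ (measure_union_null hnull (measure_singleton (0 : ℂ)))
  intro w hw
  by_cases hw0 : w = 0
  · exact Or.inr hw0
  left
  obtain ⟨z, hz, rfl⟩ := h.exists_apply_eq hb hw0
  obtain ⟨l, hl, hzl⟩ := exists_add_mem_cell (p := p) hb z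
  rw [← meromorphicOrderAt_add_period hl] at hz
  by_contra hcon
  have h1 : z + l ∉ cellLines b p := fun h1 => hcon ⟨z + l, ⟨h1, hz⟩, hl z⟩
  rcases (mem_cell_cases h1).1 hzl with h2 | h2
  · exact hw ⟨z + l, ⟨h2, hz⟩, hl z⟩
  · have h3 := h.apply_reflection hb hp (z + l)
    refine hw ⟨2 * p + b 0 + b 1 - (z + l), ⟨h2, ?_⟩, h3.trans (hl z)⟩
    rw [mem_ofPred_eq, ← h.ne_zero_iff, h3]
    exact h.ne_zero_iff.2 hz

theorem ae_regular (h : DoubleElliptic β c e f) : ∀ᵐ z, meromorphicOrderAt f z = 0 :=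
  h.countable_singular.measure_zero volume

theorem lintegral_halfCell (h : DoubleElliptic β c e f)
    (hb : (Submodule.span ℤ (range b)).toAddSubgroup = periodGroup f)
    (hp : meromorphicOrderAt f p = 2) :
    ∫⁻ z in halfCell b p, ENNReal.ofReal (pullbackDensity f z) =
      ENNReal.ofReal (4 * Real.pi) := by
  have h1 : (halfCell b p : Set ℂ) =ᵐ[volume]
      (halfCell b p ∩ {z | meromorphicOrderAt f z = 0} : Set ℂ) := by
    filter_upwards [h.ae_regular] with z hz
    exact propext ⟨fun hz1 => ⟨hz1, hz⟩, fun hz1 => hz1.1⟩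
  rw [setLIntegral_congr h1]
  simp only [pullbackDensity, ENNReal.ofReal_mul (Complex.normSq_nonneg _)]
  rw [← lintegral_image_holomorphic
      (measurableSet_halfCell.inter h.isOpen_regular.measurableSet)
      (fun z hz => (h.analyticAt (le_of_eq hz.2.symm)).differentiableAt) (h.injOn_halfCell hb hp)
      -- The area formula turns the integral into that of the spherical density over almost all of
      -- ℂ.
      (fun w => ENNReal.ofReal (sphereDensity w)),
    setLIntegral_congr (h.image_halfCell hb hp), setLIntegral_univ, lintegral_sphereDensity]

theorem lintegral_cell (h : DoubleElliptic β c e f)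
    (hb : (Submodule.span ℤ (range b)).toAddSubgroup = periodGroup f)
    (hp : meromorphicOrderAt f p = 2) :
    ∫⁻ z in cell b p, ENNReal.ofReal (pullbackDensity f z) = ENNReal.ofReal (8 * Real.pi) := by
  let ρ : ℂ → ℂ := fun z => 2 * p + b 0 + b 1 - z
  have hρ : MeasurePreserving ρ volume volume := Measure.measurePreserving_sub_left volume _
  have h1 : (cell b p : Set ℂ) =ᵐ[volume] (halfCell b p ∪ ρ ⁻¹' halfCell b p : Set ℂ) := by
    have : ∀ᵐ z, z ∉ cellLines b p := by
      rw [ae_iff]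
      simpa using volume_cellLines
    filter_upwards [this] with z hz
    exact propext (mem_cell_cases hz)
  have hdisj : Disjoint (halfCell b p) (ρ ⁻¹' halfCell b p) := by
    rw [Set.disjoint_left]
    rintro z ⟨_, _, hz⟩ ⟨_, _, hz'⟩
    have := coord_reflection (b := b) (p := p) 1 z
    simp only [ρ] at hz'
    linarith
  have h2 : ∀ z, pullbackDensity f (ρ z) = pullbackDensity f z := by
    intro z
    have h3 : (fun z => f (2 * p + b 0 + b 1 - z)) = f := funext (h.apply_reflection hb hp)
    have h4 : deriv f (ρ z) = -deriv f z := by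
      have := deriv_comp_const_sub f (2 * p + b 0 + b 1) z
      rw [h3] at this
      rw [this, neg_neg]
    rw [pullbackDensity, h4, Complex.normSq_neg, h.apply_reflection hb hp, pullbackDensity]
  have h5 := hρ.setLIntegral_comp_preimage_emb
    (MeasurableEquiv.subLeft (2 * p + b 0 + b 1)).measurableEmbedding
    (fun z => ENNReal.ofReal (pullbackDensity f z)) (halfCell b p)
  simp only [h2] at h5
  rw [setLIntegral_congr h1, lintegral_union (hρ.measurable measurableSet_halfCell) hdisj, h5,
    h.lintegral_halfCell hb hp, ← ENNReal.ofReal_add (by positivity) (by positivity)]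
  congr 1
  ring

theorem aestronglyMeasurable_pullbackDensity (h : DoubleElliptic β c e f) :
    AEStronglyMeasurable (pullbackDensity f) volume := by
  have h1 : ContinuousOn (pullbackDensity f) {z | meromorphicOrderAt f z = 0} := by
    intro z hz
    have ha := h.analyticAt (le_of_eq hz.symm)
    exact ((Complex.continuous_normSq.continuousAt.comp ha.deriv.continuousAt).mul
      (continuous_sphereDensity.continuousAt.comp ha.continuousAt)).continuousWithinAt
  have h2 := h1.aestronglyMeasurable (μ := volume) h.isOpen_regular.measurableSet
  rwa [Measure.restrict_eq_self_of_ae_mem (s := {z | meromorphicOrderAt f z = 0}) h.ae_regular]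
    at h2

/-- The spherical area, counted with multiplicity, of the image of an elliptic function of
degree two. -/
theorem setIntegral_pullbackDensity (h : DoubleElliptic β c e f)
    (hspan : Submodule.span ℝ (periodGroup f : Set ℂ) = ⊤) {F : Set ℂ}
    (hF : IsAddFundamentalDomain (periodGroup f) F volume) :
    IntegrableOn (pullbackDensity f) F ∧ ∫ z in F, pullbackDensity f z = 8 * Real.pi := by
  have := h.discreteTopology
  have : Countable (periodGroup f) := h.countable_periodGroup
  obtain ⟨b, hb⟩ := exists_lattice_basis hspan
  obtain ⟨p, hp⟩ := h.exists_zero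
  have h1 : ∫⁻ z in F, ENNReal.ofReal (pullbackDensity f z) = ENNReal.ofReal (8 * Real.pi) := by
    rw [← h.lintegral_cell hb hp]
    -- The density is periodic, so every fundamental domain gives the same value as the
    -- parallelogram.
    refine hF.setLIntegral_eq (isAddFundamentalDomain_cell hb) _ fun l z => ?_
    have h2 : f (l +ᵥ z) = f z := by
      rw [AddSubgroup.vadd_def, vadd_eq_add, add_comm]
      exact l.2 z
    have h3 : deriv f (l +ᵥ z) = deriv f z := by
      rw [AddSubgroup.vadd_def, vadd_eq_add, add_comm]
      exact deriv_add_period l.2 z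
    rw [pullbackDensity, h2, h3, pullbackDensity]
  have hm := h.aestronglyMeasurable_pullbackDensity.mono_measure
    (Measure.restrict_le_self (μ := volume) (s := F))
  refine ⟨⟨hm, ?_⟩, ?_⟩
  · rw [hasFiniteIntegral_iff_ofReal (Eventually.of_forall (pullbackDensity_nonneg f)), h1]
    exact ENNReal.ofReal_lt_top
  · rw [integral_eq_lintegral_of_nonneg_ae (Eventually.of_forall (pullbackDensity_nonneg f)) hm, h1,
      ENNReal.toReal_ofReal (by positivity)]

end DoubleElliptic

namespace RiemannType
variable {g : Cyl → ℂ} {X : Cyl → E3} {β c e : ℂ}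

theorem total_curvature (h : DoubleElliptic β c e (lift g)) (hX : HasWeierstrassPair g X)
    (hspan : Submodule.span ℝ (periodGroup (lift g) : Set ℂ) = ⊤) {F : Set ℂ}
    (hF : IsAddFundamentalDomain (periodGroup (lift g)) F volume) :
    IntegrableOn (fun z => gaussCurvature (lift X) z * areaDensity (lift X) z) F ∧
      ∫ z in F, gaussCurvature (lift X) z * areaDensity (lift X) z = -8 * Real.pi := by
  obtain ⟨h1, h2⟩ := h.setIntegral_pullbackDensity hspan hF
  have h3 : (fun z => gaussCurvature (lift X) z * areaDensity (lift X) z) =ᵐ[volume.restrict F]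
      fun z => -pullbackDensity (lift g) z := by
    filter_upwards [ae_restrict_of_ae h.ae_regular] with z hz
    exact gaussCurvature_mul_areaDensity h hX hz
  refine ⟨h1.neg.congr h3.symm, ?_⟩
  rw [integral_congr_ae h3, integral_neg, h2]
  ring

end RiemannType

/-! ### Properness and conclusion. -/

theorem compactSpace_quotient {L : AddSubgroup ℂ} [DiscreteTopology L]
    (hspan : Submodule.span ℝ (L : Set ℂ) = ⊤) : CompactSpace (ℂ ⧸ L) := by
  obtain ⟨b, hb⟩ := exists_lattice_basis hspan
  have h1 := (ZSpan.fundamentalDomain_isBounded b).isCompact_closure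
  rw [← isCompact_univ_iff]
  convert h1.image (f := (QuotientAddGroup.mk : ℂ → ℂ ⧸ L)) continuous_quot_mk
  refine (eq_univ_of_forall fun t => ?_).symm
  obtain ⟨z, rfl⟩ := QuotientAddGroup.mk_surjective t
  refine ⟨ZSpan.fract b z, subset_closure (ZSpan.fract_mem_fundamentalDomain b z), ?_⟩
  rw [QuotientAddGroup.eq, ZSpan.fract_apply, neg_sub, sub_add_cancel, ← hb]
  exact (ZSpan.floor b z).2

namespace RiemannType

theorem IsPlanarEnd.eventually_lt_norm {Y : ℂ → E3} {p : ℂ} (h : IsPlanarEnd Y p) (M : ℝ) :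
    ∀ᶠ z in 𝓝[≠] p, M < ‖Y z‖ := by
  obtain ⟨T, -, -, -, -, -, -, -, -, -, -, -, -, h⟩ := h
  filter_upwards [h.eventually_gt_atTop (M ^ 2)] with z hz
  rw [← T.norm_map]
  refine lt_of_pow_lt_pow_left₀ 2 (norm_nonneg _) (hz.trans_le ?_)
  rw [EuclideanSpace.norm_sq_eq, Fin.sum_univ_three]
  simp only [Real.norm_eq_abs, sq_abs]
  linarith [sq_nonneg (T (Y z) 2)]

/-- The third coordinates of `x` and `y` bound the number of copies of `v` between them, because `v`
is not horizontal. -/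
theorem norm_le_of_sub_mem_zmultiples {v x y : E3} (hv : v 2 ≠ 0)
    (hxy : x - y ∈ AddSubgroup.zmultiples v) :
    ‖x‖ ≤ ‖y‖ + (|x 2| + ‖y‖) / |v 2| * ‖v‖ := by
  obtain ⟨k, hk⟩ := AddSubgroup.mem_zmultiples_iff.1 hxy
  rw [← Int.cast_smul_eq_zsmul ℝ] at hk
  have h2 : (k : ℝ) * v 2 = x 2 - y 2 := by
    have := congrArg (fun u : E3 => u 2) hk
    simpa using this
  have hy : |y 2| ≤ ‖y‖ := by
    simpa using PiLp.norm_apply_le y 2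
  have h3 : |(k : ℝ)| ≤ (|x 2| + ‖y‖) / |v 2| := by
    rw [le_div_iff₀ (abs_pos.2 hv), ← abs_mul, h2]
    exact (abs_sub _ _).trans (by linarith)
  calc ‖x‖ = ‖y + (k : ℝ) • v‖ := by rw [hk, add_sub_cancel]
    _ ≤ ‖y‖ + ‖(k : ℝ) • v‖ := norm_add_le _ _
    _ ≤ _ := by
      rw [norm_smul, Real.norm_eq_abs]
      gcongr

theorem t2Space_quotient_zmultiples (v : E3) : T2Space (E3 ⧸ AddSubgroup.zmultiples v) := by
  let _ : NormedSpace ℚ E3 := NormedSpace.restrictScalars ℚ ℝ E3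
  have : IsClosed (AddSubgroup.zmultiples v : Set E3) := AddSubgroup.isClosed_of_discrete
  infer_instance

variable {g : Cyl → ℂ} {X : Cyl → E3} {β c e : ℂ}

theorem continuous_of_mk_eq (hX : HasWeierstrassPair g X) {v : E3}
    {Y : OrientableQuotient g X → E3 ⧸ AddSubgroup.zmultiples v}
    (hY : ∀ x : puncturedCyl g, Y (Quotient.mk (translationSetoid g X) x) =
      ((X x : E3) : E3 ⧸ AddSubgroup.zmultiples v)) : Continuous Y := by
  refine isQuotientMap_quotient_mk'.continuous_iff.2 ?_
  have h1 : Continuous fun x : puncturedCyl g => X x := by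
    rw [continuous_iff_continuousAt]
    rintro ⟨x, hx⟩
    obtain ⟨z, rfl⟩ := QuotientAddGroup.mk_surjective x
    refine ContinuousAt.comp (g := X) ?_ continuous_subtype_val.continuousAt
    have h2 : Tendsto (lift X) (𝓝 z) (𝓝 (X (z : Cyl))) :=
      continuousAt_lift hX (mem_puncturedCyl_iff.1 hx)
    rw [ContinuousAt, QuotientAddGroup.nhds_eq, tendsto_map'_iff]
    exact h2
  have h3 : Continuous fun x : puncturedCyl g => ((X x : E3) : E3 ⧸ AddSubgroup.zmultiples v) :=
    continuous_quot_mk.comp h1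
  convert h3 using 1
  exact funext hY

/-- Near a puncture, the surface leaves every compact subset of the quotient of space. -/
theorem eventually_mk_notMem (h : DoubleElliptic β c e (lift g)) (hX : HasWeierstrassPair g X)
    {v : E3} (hv : v 2 ≠ 0) {p : ℂ} (hend : IsPlanarEnd (lift X) p) (y : E3) :
    ∀ᶠ z : ℂ in 𝓝[≠] p, ((X (z : Cyl) : E3) : E3 ⧸ AddSubgroup.zmultiples v) ∉
      (QuotientAddGroup.mk : E3 → E3 ⧸ AddSubgroup.zmultiples v) '' Metric.ball y 1 := by
  obtain ⟨b, hb⟩ := exists_height h hX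
  have h1 : ∀ᶠ z in 𝓝[≠] p, |z.re + b| < |p.re + b| + 1 := by
    refine ContinuousAt.eventually_lt (f := fun z : ℂ => |z.re + b|) (by fun_prop)
      continuousAt_const (by simp) |>.filter_mono nhdsWithin_le_nhds
  filter_upwards [eventually_nhdsNE_mem_regularSet h p, h1, hend.eventually_lt_norm
    (‖y‖ + 1 + (|p.re + b| + 1 + (‖y‖ + 1)) / |v 2| * ‖v‖)] with z hz hzb hzM
  rintro ⟨y', hy', heq⟩
  rw [QuotientAddGroup.eq, neg_add_eq_sub] at heq
  have h2 := norm_le_of_sub_mem_zmultiples hv heq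
  have h3 : ‖y'‖ ≤ ‖y‖ + 1 := by
    have := norm_sub_norm_le y' y
    rw [Metric.mem_ball, dist_eq_norm] at hy'
    linarith
  have h4 : |X (z : Cyl) 2| ≤ |p.re + b| + 1 := by
    have := hb z hz
    simp only [lift] at this
    rw [this]
    exact hzb.le
  refine absurd (h2.trans ?_) (not_le.2 hzM)
  gcongr

/-- An ultrafilter on the quotient has a limit in the compact torus. If its image in space
converges, that limit is not a puncture: near a puncture the height stays bounded while the norm
tends to infinity, so the surface avoids a neighbourhood of any given point of ℝ³ / ⟨v⟩. -/
theorem isProperMap_of_planar_ends (h : DoubleElliptic β c e (lift g)) (hX : HasWeierstrassPair g X)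
    (hspan : Submodule.span ℝ (periodGroup (lift g) : Set ℂ) = ⊤) {v : E3} (hv : v 2 ≠ 0)
    {p q : ℂ} (hp : meromorphicOrderAt (lift g) p = 2) (hq : meromorphicOrderAt (lift g) q = -2)
    {Y : OrientableQuotient g X → E3 ⧸ AddSubgroup.zmultiples v}
    (hY : ∀ x : puncturedCyl g, Y (Quotient.mk (translationSetoid g X) x) =
      ((X x : E3) : E3 ⧸ AddSubgroup.zmultiples v)) : IsProperMap Y := by
  have := h.discreteTopology
  have := compactSpace_quotient hspan
  have := t2Space_quotient_zmultiples v
  have hcont := continuous_of_mk_eq hX hY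
  obtain ⟨ψ, hψ⟩ := exists_quotient_homeomorph h hX hp hq
  refine isProperMap_iff_ultrafilter_of_t2.2 ⟨hcont, fun 𝒰 y hy => ?_⟩
  let π : OrientableQuotient g X → ℂ ⧸ periodGroup (lift g) := fun x => ψ x
  obtain ⟨t, -, ht⟩ := isCompact_univ.ultrafilter_le_nhds (𝒰.map π) (by simp)
  have ht' : Tendsto π 𝒰 (𝓝 t) := ht
  have hends : ∀ r : ℂ, (r = p ∨ r = q) → t ≠ r := by
    rintro r hr rfl
    have hend : IsPlanarEnd (lift X) r := by
      rcases hr with rfl | rfl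
      · exact isPlanarEnd_zero h hX hp
      · exact isPlanarEnd_pole h hX hq
    obtain ⟨y, rfl⟩ := QuotientAddGroup.mk_surjective y
    have h1 := eventually_mk_notMem h hX hv hend y
    rw [eventually_nhdsWithin_iff] at h1
    rw [QuotientAddGroup.nhds_eq] at ht' hy
    have h2 : ∀ᶠ x in (𝒰 : Filter (OrientableQuotient g X)), Y x ∈
        (QuotientAddGroup.mk : E3 → E3 ⧸ AddSubgroup.zmultiples v) '' Metric.ball y 1 :=
      hy (image_mem_map (Metric.ball_mem_nhds y one_pos))
    have h3 := ht' (image_mem_map h1)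
    obtain ⟨x, hx2, z, hz, hzx⟩ := (h2.and h3).exists
    have hne : (z : ℂ ⧸ periodGroup (lift g)) ≠ p ∧ (z : ℂ ⧸ periodGroup (lift g)) ≠ q := by
      rw [hzx]
      exact (ψ x).2
    have hzr : z ≠ r := by
      rintro rfl
      rcases hr with rfl | rfl
      · exact hne.1 rfl
      · exact hne.2 rfl
    have hzreg := mem_puncturedCyl_iff.2 ((mem_regularSet_iff_torus h hp hq).2 hne)
    have hxz : x = Quotient.mk (translationSetoid g X) ⟨(z : Cyl), hzreg⟩ := by
      apply ψ.injective
      apply Subtype.ext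
      rw [hψ z hzreg]
      exact hzx.symm
    rw [hxz, hY] at hx2
    exact hz hzr hx2
  let s : {t : ℂ ⧸ periodGroup (lift g) // t ≠ p ∧ t ≠ q} :=
    ⟨t, hends p (Or.inl rfl), hends q (Or.inr rfl)⟩
  have h4 : Tendsto ψ 𝒰 (𝓝 s) := by
    rw [tendsto_subtype_rng]
    exact ht'
  have h5 : Tendsto id (𝒰 : Filter (OrientableQuotient g X)) (𝓝 (ψ.symm s)) := by
    have := (ψ.symm.continuous.tendsto s).comp h4
    convert this
    ext x
    simp
  exact ⟨ψ.symm s, h5⟩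

theorem quotientIsTwoEndedTorus (h : DoubleElliptic β c e (lift g)) (hX : HasWeierstrassPair g X)
    (hre : ∃ l ∈ periodGroup (lift g), l.re ≠ 0) {v : E3} (hv : v 2 ≠ 0)
    (hvw : ∀ w : E3, (∃ φ, IsOrientedTranslation g X w φ) ↔ w ∈ AddSubgroup.zmultiples v) :
    QuotientIsTwoEndedTorus g X v (-8 * Real.pi) := by
  have hspan := span_eq_top_of_re_ne_zero (I_mem_periodGroup g) hre
  obtain ⟨p, hp⟩ := h.exists_zero
  obtain ⟨q, hq⟩ := h.exists_pole
  let Y : OrientableQuotient g X → E3 ⧸ AddSubgroup.zmultiples v :=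
    Quotient.lift (fun x => ((X x : E3) : E3 ⧸ AddSubgroup.zmultiples v)) (by
      rintro x y ⟨w, φ, hφ, rfl⟩
      rw [QuotientAddGroup.eq, (hφ x).1, neg_add_cancel_left]
      exact (hvw w).1 ⟨φ, hφ⟩)
  refine ⟨periodGroup (lift g), p, q, ⟨h.discreteTopology, hspan⟩, ?_,
    exists_quotient_homeomorph h hX hp hq, ⟨Y, fun x => rfl,
      isProperMap_of_planar_ends h hX hspan hv hp hq fun x => rfl⟩,
    fun z hzp hzq => isMinimalImmersionAt h hX ((mem_regularSet_iff_torus h hp hq).2 ⟨hzp, hzq⟩),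
    isPlanarEnd_zero h hX hp, isPlanarEnd_pole h hX hq, fun F hF => total_curvature h hX hspan hF⟩
  rw [Ne, torus_coe_eq_iff, ← h.zero_iff hp, hq]
  decide

end RiemannType

theorem mainTheorem9 (g : RiemannType.Cyl → ℂ) (X : RiemannType.Cyl → RiemannType.E3)
    (hM : RiemannType.IsRiemannTypeSurface g X) (hS : RiemannType.ShiffmanLinear g) :
    ∃ v : RiemannType.E3, v ≠ 0 ∧
      (fun y => y + v) '' (X '' RiemannType.puncturedCyl g) = X '' RiemannType.puncturedCyl g ∧
      (∀ w : RiemannType.E3,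
        (∃ φ : RiemannType.puncturedCyl g ≃ₜ RiemannType.puncturedCyl g,
          RiemannType.IsOrientedTranslation g X w φ) ↔ w ∈ AddSubgroup.zmultiples v) ∧
      RiemannType.QuotientIsTwoEndedTorus g X v (-8 * Real.pi) := by
  obtain ⟨β, c, e, h⟩ := hS.doubleElliptic hM.memMimm.memW
  have hre := hM.memMimm.memW.exists_period_re_ne_zero h
  obtain ⟨v, hv, hvw⟩ := RiemannType.exists_generator h hM.weierstrass hre
  obtain ⟨φ, hφ⟩ := (hvw v).2 (AddSubgroup.mem_zmultiples v)
  refine ⟨v, ?_, RiemannType.image_translate hφ, hvw,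
    RiemannType.quotientIsTwoEndedTorus h hM.weierstrass hre hv hvw⟩
  rintro rfl
  exact hv rfl
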